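/- Let $d,n,T$ be non-negative integers, $\sigma>0$, $\theta\in\mathbb{R}^d$, and let $X_1,\dots,X_n$ be i.i.d. samples from $P_\theta=\mathcal{N}(\theta,\sigma^2 I_d)$, held by $n$ distinct nodes. The nodes communicate over a public blackboard: on round $t=1,\dots,T$, node $i=1,\dots,n$ in turn writes a message $Y_{i,t}$ with values in a measurable space carrying a $\sigma$-finite measure $\nu_{i,t}$, drawn from a channel with transition density $p(y_{i,t}\mid x_i,y_{i-1,t},\dots,y_{1,t},\pi_{t-1},\dots,\pi_1)$ with respect to $\nu_{i,t}$, where $\pi_s=(y_{1,s},\dots,y_{n,s})$ (jointly measurable in all arguments, otherwise arbitrary, and not depending on $\theta$). Let $\Pi=(\Pi_1,\dots,\Pi_T)$ be the total transcript, with density $$p_\theta(\pi)=\mathbb{E}_{X_1,\dots,X_n\sim P_\theta}\Big[\prod_{t=1}^{T}\prod_{i=1}^n p(y_{i,t}\mid X_i,y_{i-1,t},\dots,y_{1,t},\pi_{t-1},\dots,\pi_1)\Big]$$ with respect to the product of the $\nu_{i,t}$; let $I_\Pi(\theta)=\mathbb{E}\big[(\nabla_\theta\log p_\theta(\Pi))(\nabla_\theta\log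 p_\theta(\Pi))^{T}\big]$ be its Fisher information matrix, and let $I_\theta(X_1,\dots,X_n;\Pi)\in[0,\infty]$ be the mutual information, in nats, between $(X_1,\dots,X_n)$ and $\Pi$. Then: (a) $\log p_{(\cdot)}(\Pi)$ is almost surely differentiable at $\theta$, $\nabla_\theta\log p_\theta(\Pi)$ is square integrable, and $$\mathsf{Tr}(I_\Pi(\theta))\le\frac{2}{\sigma^2}\,I_\theta(X_1,\dots,X_n;\Pi).$$ (b) The constant $2$ is optimal: let $d=T=1$, and let each node send $Y_i=X_i+W_i$ with independent noise $W_i\sim\mathcal{N}(0,\sigma_{\mathrm{noise}}^2)$, so that $\Pi=(Y_1,\dots,Y_n)$. For every $n\ge1$, $\sigma>0$, $\theta\in\mathbb{R}$ and $c<2$, if $\sigma_{\mathrm{noise}}^2$ is large enough, then $\mathsf{Tr}(I_\Pi(\theta))>\frac{c}{\sigma^2}I_\theta(X_1,\dots,X_n;\Pi)$. -/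

import Mathlib

open MeasureTheory ProbabilityTheory InformationTheory
open scoped ENNReal NNReal

noncomputable section

/-! ### Fisher information of a dominated family -/

section Fisher

variable {d : ℕ} {Ω : Type*} [MeasurableSpace Ω]

/-- The score `∇_θ log p_θ(y)` of a family of densities `p θ : Ω → [0, ∞]`. -/
def score (p : EuclideanSpace ℝ (Fin d) → Ω → ℝ≥0∞) (θ : EuclideanSpace ℝ (Fin d)) (y : Ω) :
    EuclideanSpace ℝ (Fin d) :=
  gradient (fun η => Real.log (p η y).toReal) θ

/-- The Fisher information matrix `E[(∇_θ log p_θ(Y)) (∇_θ log p_θ(Y))ᵀ]`, where `Y` has density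
`p θ` with respect to `ν`. -/
def fisherInformation (ν : Measure Ω) (p : EuclideanSpace ℝ (Fin d) → Ω → ℝ≥0∞)
    (θ : EuclideanSpace ℝ (Fin d)) : Matrix (Fin d) (Fin d) ℝ :=
  Matrix.of fun j k => ∫ y, score p θ y j * score p θ y k ∂(ν.withDensity (p θ))

end Fisher

/-! ### Mutual information -/

/-- The mutual information (in nats) of the two components of a pair with joint law `ρ`:
the Kullback–Leibler divergence of `ρ` from the product of its marginals. -/
def mutualInformation {α β : Type*} [MeasurableSpace α] [MeasurableSpace β]
    (ρ : Measure (α × β)) : ℝ≥0∞ :=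
  klDiv ρ ((ρ.map Prod.fst).prod (ρ.map Prod.snd))

/-! ### Interactive blackboard protocols -/

/-- A slot `(t, i)` is the message of node `i` in round `t`. The messages written before it are
those of earlier rounds and those of the nodes `j < i` in the same round. -/
def Precedes {n T : ℕ} (a b : Fin T × Fin n) : Prop :=
  a.1 < b.1 ∨ (a.1 = b.1 ∧ a.2 < b.2)

/-- A full blackboard transcript `(y_{i,t})`; the message in slot `k` lies in the space `𝒴 k`. -/
abbrev Transcript {n T : ℕ} (𝒴 : Fin T × Fin n → Type*) : Type _ :=
  ∀ k, 𝒴 k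

/-- The part of the transcript that is on the blackboard just before slot `k`. -/
abbrev History {n T : ℕ} (𝒴 : Fin T × Fin n → Type*) (k : Fin T × Fin n) : Type _ :=
  ∀ a : {a : Fin T × Fin n // Precedes a k}, 𝒴 a.1

/-- An interactive protocol with `n` nodes holding data in `𝒳` and `T` rounds: for each slot
`k = (t, i)` a channel with transition density `p(y | x_i, history)` with respect to `ν k`. -/
structure Protocol (𝒳 : Type*) [MeasurableSpace 𝒳] (n T : ℕ) (𝒴 : Fin T × Fin n → Type*)
    [∀ k, MeasurableSpace (𝒴 k)] (ν : ∀ k, Measure (𝒴 k)) where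
  /-- the transition density of slot `k` -/
  dens : ∀ k, 𝒳 → History 𝒴 k → 𝒴 k → ℝ≥0∞
  measurable_dens : ∀ k, Measurable fun q : 𝒳 × History 𝒴 k × 𝒴 k => dens k q.1 q.2.1 q.2.2
  lintegral_dens : ∀ k x h, ∫⁻ y, dens k x h y ∂(ν k) = 1

namespace Protocol

variable {𝒳 : Type*} [MeasurableSpace 𝒳] {n T : ℕ} {𝒴 : Fin T × Fin n → Type*}
  [∀ k, MeasurableSpace (𝒴 k)] {ν : ∀ k, Measure (𝒴 k)}

/-- The conditional density of the transcript given the data, the product over all slots of the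
transition densities; slot `k = (t, i)` uses the data `x i` of node `i`. -/
def condDensity (P : Protocol 𝒳 n T 𝒴 ν) (x : Fin n → 𝒳) (π : Transcript 𝒴) : ℝ≥0∞ :=
  ∏ k : Fin T × Fin n, P.dens k (x k.2) (fun a => π a.1) (π k)

/-- The density of the transcript with respect to the product of the `ν k` when the data have
law `μ`. -/
def transcriptDensity (P : Protocol 𝒳 n T 𝒴 ν) (μ : Measure (Fin n → 𝒳))
    (π : Transcript 𝒴) : ℝ≥0∞ :=
  ∫⁻ x, P.condDensity x π ∂μ

/-- The joint law of the data and the transcript when the data have law `μ`. -/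
def jointLaw [∀ k, SigmaFinite (ν k)] (P : Protocol 𝒳 n T 𝒴 ν) (μ : Measure (Fin n → 𝒳)) :
    Measure ((Fin n → 𝒳) × Transcript 𝒴) :=
  (μ.prod (Measure.pi ν)).withDensity fun z => P.condDensity z.1 z.2

end Protocol

/-! ### The Gaussian location model -/

/-- The law of `n` i.i.d. samples from `N(θ, σ² I_d)`. -/
def gaussianSample (d n : ℕ) (σ : ℝ) (θ : EuclideanSpace ℝ (Fin d)) :
    Measure (Fin n → EuclideanSpace ℝ (Fin d)) :=
  Measure.pi fun _ => multivariateGaussian θ (σ ^ 2 • (1 : Matrix (Fin d) (Fin d) ℝ))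

namespace Protocol

variable {d n T : ℕ} {𝒴 : Fin T × Fin n → Type*} [∀ k, MeasurableSpace (𝒴 k)]
  {ν : ∀ k, Measure (𝒴 k)}

/-- The density `p_θ(π)` of the transcript in the Gaussian location model. -/
def gaussianDensity (P : Protocol (EuclideanSpace ℝ (Fin d)) n T 𝒴 ν) (σ : ℝ)
    (θ : EuclideanSpace ℝ (Fin d)) (π : Transcript 𝒴) : ℝ≥0∞ :=
  P.transcriptDensity (gaussianSample d n σ θ) π

variable [∀ k, SigmaFinite (ν k)]

/-- The law of the transcript in the Gaussian location model. -/
def gaussianLaw (P : Protocol (EuclideanSpace ℝ (Fin d)) n T 𝒴 ν) (σ : ℝ)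
    (θ : EuclideanSpace ℝ (Fin d)) : Measure (Transcript 𝒴) :=
  (Measure.pi ν).withDensity (P.gaussianDensity σ θ)

/-- The Fisher information matrix `I_Π(θ)` of the transcript in the Gaussian location model. -/
def gaussianFisher (P : Protocol (EuclideanSpace ℝ (Fin d)) n T 𝒴 ν) (σ : ℝ)
    (θ : EuclideanSpace ℝ (Fin d)) : Matrix (Fin d) (Fin d) ℝ :=
  fisherInformation (Measure.pi ν) (P.gaussianDensity σ) θ

/-- The mutual information `I_θ(X_1, …, X_n; Π)` in the Gaussian location model. -/
def gaussianInformation (P : Protocol (EuclideanSpace ℝ (Fin d)) n T 𝒴 ν) (σ : ℝ)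
    (θ : EuclideanSpace ℝ (Fin d)) : ℝ≥0∞ :=
  mutualInformation (P.jointLaw (gaussianSample d n σ θ))

end Protocol

/-- The one-round protocol with real data in which every node sends `Y_i = X_i + W_i`, with
independent noise `W_i ∼ N(0, v)`. -/
def awgnProtocol (n : ℕ) (v : ℝ≥0) (hv : v ≠ 0) :
    Protocol (EuclideanSpace ℝ (Fin 1)) n 1 (fun _ => ℝ) (fun _ => volume) where
  dens _ x _ y := gaussianPDF (x 0) v y
  measurable_dens k := by
    simp only [gaussianPDF, gaussianPDFReal]
    fun_prop
  lintegral_dens _ x _ := lintegral_gaussianPDF_eq_one (x 0) hv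

end

/-! ### Products of measures and of densities -/

section ProductMeasures

variable {ι : Type*} {α : ι → Type*} [∀ i, MeasurableSpace (α i)]

/-! Write `m_i(Π) = E[X_i - θ | Π]`. Changing `θ` to `η` multiplies the law of the data by an
explicit exponential, so `p_η(π) / p_θ(π)` is a posterior moment generating function times `exp(-n‖η
- θ‖² / (2σ²))` (`toReal_gaussianDensity_eq`). Differentiating at `η = θ` shows that the score is
`σ⁻² ∑ m_i(Π)` (`ae_hasGradientAt_log_gaussianDensity`).

For a fixed transcript the likelihood is a product of functions of the separate data, so independent
data stay independent under the posterior (`posterior_pi`). Hence `E⟨m_i, m_j⟩ = E⟨X_i - θ, X_j - θ⟩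
= 0` for `i ≠ j`, and the trace of the Fisher information is `σ⁻⁴ ∑ E‖m_i‖²`.

This sum is controlled by the Donsker–Varadhan inequality (`ofReal_integral_le_klDiv`) on the joint
law against the product of its marginals. The test function is the log-density, given `π`, of moving
the mean of each `X_i` by `m_i(π)`. Its exponential integrates to one under the product, and its
mean under the joint law is `∑ E‖m_i‖² / (2σ²)`, which is thus at most the mutual information
(`ofReal_sum_integral_posteriorDeviation_le`).

For optimality, additive noise of variance `v` gives Fisher information `n / (σ² + v)` and mutual
information `(n/2) log(1 + σ²/v) ≤ nσ² / (2v)`. The ratio to `I/σ²` is therefore at least `2v / (σ²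
+ v)`, which tends to `2`. -/

theorem lmarginal_prod_eval [DecidableEq ι] (μ : ∀ i, Measure (α i)) [∀ i, SigmaFinite (μ i)]
    {f : ∀ i, α i → ℝ≥0∞} (hf : ∀ i, Measurable (f i)) (s : Finset ι) (y : ∀ i, α i) :
    lmarginal μ s (fun y => ∏ i ∈ s, f i (y i)) y = ∏ i ∈ s, ∫⁻ a, f i a ∂(μ i) := by
  induction s using Finset.induction_on generalizing y with
  | empty => simp
  | insert a s ha ih =>
    rw [lmarginal_insert' _ (by fun_prop) ha, Finset.prod_insert ha, ← ih y]
    have : (fun x : ∀ i, α i => ∫⁻ z, ∏ i ∈ insert a s, f i (Function.update x a z i) ∂(μ a))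
        = fun x => (∫⁻ z, f a z ∂(μ a)) * ∏ i ∈ s, f i (x i) := by
      funext x
      rw [← lintegral_mul_const _ (hf a)]
      refine lintegral_congr fun z => ?_
      rw [Finset.prod_insert ha, Function.update_self]
      congr 1
      refine Finset.prod_congr rfl fun i hi => ?_
      rw [Function.update_of_ne (ne_of_mem_of_not_mem hi ha)]
    rw [this]
    simp only [lmarginal]
    rw [lintegral_const_mul]
    exact Finset.measurable_prod _ fun i _ => (hf i).comp
      ((measurable_pi_apply i).comp measurable_updateFinset)

variable [Fintype ι]

theorem lintegral_pi_prod_eval (μ : ∀ i, Measure (α i)) [∀ i, SigmaFinite (μ i)]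
    {f : ∀ i, α i → ℝ≥0∞} (hf : ∀ i, Measurable (f i)) :
    ∫⁻ y, ∏ i, f i (y i) ∂(Measure.pi μ) = ∏ i, ∫⁻ a, f i a ∂(μ i) := by
  classical
  -- Passing to marginal integrals needs a base point, so an empty product is treated apart; there
  -- both sides vanish.
  rcases isEmpty_or_nonempty (∀ i, α i) with h | ⟨⟨y⟩⟩
  · obtain ⟨i, hi⟩ := isEmpty_pi.mp h
    rw [Finset.prod_eq_zero (Finset.mem_univ i)]
    · simp [Measure.eq_zero_of_isEmpty]
    · simp [Measure.eq_zero_of_isEmpty]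
  · rw [lintegral_eq_lmarginal_univ y, lmarginal_prod_eval μ hf]

theorem pi_withDensity (μ : ∀ i, Measure (α i)) [∀ i, SigmaFinite (μ i)]
    {f : ∀ i, α i → ℝ≥0∞} (hf : ∀ i, Measurable (f i))
    [∀ i, SigmaFinite ((μ i).withDensity (f i))] :
    Measure.pi (fun i => (μ i).withDensity (f i))
      = (Measure.pi μ).withDensity fun y => ∏ i, f i (y i) := by
  refine (Measure.pi_eq fun s hs => ?_)
  rw [withDensity_apply _ (MeasurableSet.univ_pi hs), ← lintegral_indicator (MeasurableSet.univ_pi hs)]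
  have : (Set.univ.pi s).indicator (fun y : ∀ i, α i => ∏ i, f i (y i))
      = fun y => ∏ i, (s i).indicator (f i) (y i) := by
    funext y
    by_cases h : y ∈ Set.univ.pi s
    · rw [Set.indicator_of_mem h]
      exact Finset.prod_congr rfl fun i _ => (Set.indicator_of_mem (h i trivial) _).symm
    · rw [Set.indicator_of_notMem h]
      simp only [Set.mem_univ_pi, not_forall] at h
      obtain ⟨i, hi⟩ := h
      exact (Finset.prod_eq_zero (Finset.mem_univ i) (Set.indicator_of_notMem hi _)).symm
  rw [this, lintegral_pi_prod_eval μ fun i => (hf i).indicator (hs i)]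
  refine Finset.prod_congr rfl fun i _ => ?_
  rw [lintegral_indicator (hs i), withDensity_apply _ (hs i)]

/-- Distinct coordinates of a product of probability measures are uncorrelated. -/
theorem integral_pi_inner {d n : ℕ} (τ : Fin n → Measure (EuclideanSpace ℝ (Fin d)))
    [∀ i, IsProbabilityMeasure (τ i)] (θ : EuclideanSpace ℝ (Fin d))
    (h : ∀ i, Integrable (fun x => x - θ) (τ i)) {i j : Fin n} (hij : i ≠ j) :
    ∫ x, inner ℝ (x i - θ) (x j - θ) ∂(Measure.pi τ)
      = inner ℝ (∫ x, (x - θ) ∂(τ i)) (∫ x, (x - θ) ∂(τ j)) := by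
  have hind : IndepFun (fun x : Fin n → EuclideanSpace ℝ (Fin d) => x i - θ)
      (fun x => x j - θ) (Measure.pi τ) :=
    (iIndepFun_pi (μ := τ) (X := fun _ x => x - θ)
      (fun i => (measurable_id.sub_const θ).aemeasurable)).indepFun hij
  have hint (i : Fin n) : Integrable (fun x : Fin n → EuclideanSpace ℝ (Fin d) => x i - θ)
      (Measure.pi τ) := integrable_comp_eval (μ := τ) (f := fun x => x - θ) (h i)
  have hc (i : Fin n) (k : Fin d) : Integrable
      (fun x : Fin n → EuclideanSpace ℝ (Fin d) => (x i - θ) k) (Measure.pi τ) :=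
    (EuclideanSpace.proj (𝕜 := ℝ) k).integrable_comp (hint i)
  have hi (k : Fin d) : IndepFun (fun x : Fin n → EuclideanSpace ℝ (Fin d) => (x i - θ) k)
      (fun x => (x j - θ) k) (Measure.pi τ) :=
    by
    have hk : Measurable fun z : EuclideanSpace ℝ (Fin d) => z k := by fun_prop
    exact hind.comp hk hk
  have hp (i : Fin n) (k : Fin d) :
      ∫ x, (x i - θ) k ∂(Measure.pi τ) = (∫ x, (x - θ) ∂(τ i)) k := by
    rw [integral_comp_eval (μ := τ) (i := i) (f := fun x => (x - θ) k) (by fun_prop)]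
    exact (EuclideanSpace.proj (𝕜 := ℝ) k).integral_comp_comm (h i)
  simp only [PiLp.inner_apply, RCLike.inner_apply, conj_trivial]
  rw [integral_finsetSum]
  · refine Finset.sum_congr rfl fun k _ => ?_
    rw [← hp, ← hp]
    exact (hi k).symm.integral_mul_eq_mul_integral (hc _ _).aestronglyMeasurable (hc _ _).aestronglyMeasurable
  · exact fun k _ => (hi k).symm.integrable_mul (hc _ _) (hc _ _)

end ProductMeasures

/-! ### A variational bound on relative entropy -/

section Entropy

variable {Ω : Type*} [MeasurableSpace Ω]

/-- The Donsker–Varadhan lower bound on the Kullback–Leibler divergence. -/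
theorem ofReal_integral_le_klDiv {ρ Q : Measure Ω} [IsProbabilityMeasure ρ]
    [IsProbabilityMeasure Q] {φ : Ω → ℝ} (hφ : Integrable φ ρ)
    (he : Integrable (fun z => Real.exp (φ z)) Q) (h1 : ∫ z, Real.exp (φ z) ∂Q = 1) :
    ENNReal.ofReal (∫ z, φ z ∂ρ) ≤ klDiv ρ Q := by
  by_cases htop : klDiv ρ Q = ∞
  · simp [htop]
  obtain ⟨hac, hint⟩ := klDiv_ne_top_iff.mp htop
  have := isProbabilityMeasure_tilted he
  -- Gibbs' inequality for `ρ` against `Q` tilted by `φ`; the normalising constant of the tilt is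
  -- `1`, so its logarithm drops out.
  have h := integral_llr_add_sub_measure_univ_nonneg
    (hac.trans (absolutelyContinuous_tilted he)) (integrable_llr_tilted_right hac hφ hint he)
  rw [integral_llr_tilted_right hac hφ he hint, h1] at h
  rw [klDiv_of_ac_of_integrable hac hint]
  apply ENNReal.ofReal_le_ofReal
  simp at h ⊢
  linarith

end Entropy

/-! ### Disintegrating a density on a product -/

section Fubini

variable {α β V : Type*} [MeasurableSpace α] [MeasurableSpace β]
  [NormedAddCommGroup V] [NormedSpace ℝ V]
  {μ : Measure α} {ν : Measure β} [SFinite μ] [SFinite ν] {r : α × β → ℝ≥0∞} {F : α × β → V}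

/-- Finiteness on almost every section is what lets `r` be replaced by `toReal` there, reducing
Bochner integrals against the weighted measures to ordinary Fubini. -/
theorem ae_ae_lt_top_of_lintegral_ne_top (hr : Measurable r) (hfin : ∫⁻ z, r z ∂(μ.prod ν) ≠ ∞) :
    ∀ᵐ b ∂ν, ∀ᵐ a ∂μ, r (a, b) < ∞ := by
  have h := ae_lt_top hr hfin
  rw [← Measure.prod_swap, ae_map_iff measurable_swap.aemeasurable
    (measurableSet_lt hr measurable_const)] at h
  exact Measure.ae_ae_of_ae_prod h

theorem ae_integrable_withDensity_section (hr : Measurable r)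
    (hfin : ∫⁻ z, r z ∂(μ.prod ν) ≠ ∞) (hF : Integrable F ((μ.prod ν).withDensity r)) :
    ∀ᵐ b ∂ν, Integrable (fun a => F (a, b)) (μ.withDensity fun a => r (a, b)) := by
  rw [integrable_withDensity_iff_integrable_smul' hr (ae_lt_top hr hfin)] at hF
  filter_upwards [hF.prod_left_ae, ae_ae_lt_top_of_lintegral_ne_top hr hfin] with b hb hlt
  rwa [integrable_withDensity_iff_integrable_smul' (by fun_prop) hlt]

theorem integral_withDensity_section_ae_eq (hr : Measurable r)
    (hfin : ∫⁻ z, r z ∂(μ.prod ν) ≠ ∞) :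
    (fun b => ∫ a, F (a, b) ∂(μ.withDensity fun a => r (a, b)))
      =ᵐ[ν] fun b => ∫ a, (r (a, b)).toReal • F (a, b) ∂μ := by
  filter_upwards [ae_ae_lt_top_of_lintegral_ne_top hr hfin] with b hlt
  rw [integral_withDensity_eq_integral_toReal_smul (by fun_prop) hlt]

theorem integrable_integral_withDensity_section (hr : Measurable r)
    (hfin : ∫⁻ z, r z ∂(μ.prod ν) ≠ ∞) (hF : Integrable F ((μ.prod ν).withDensity r)) :
    Integrable (fun b => ∫ a, F (a, b) ∂(μ.withDensity fun a => r (a, b))) ν := by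
  rw [integrable_withDensity_iff_integrable_smul' hr (ae_lt_top hr hfin)] at hF
  exact hF.integral_prod_right.congr (integral_withDensity_section_ae_eq hr hfin).symm

theorem integral_prod_withDensity (hr : Measurable r)
    (hfin : ∫⁻ z, r z ∂(μ.prod ν) ≠ ∞) (hF : Integrable F ((μ.prod ν).withDensity r)) :
    ∫ z, F z ∂((μ.prod ν).withDensity r)
      = ∫ b, ∫ a, F (a, b) ∂(μ.withDensity fun a => r (a, b)) ∂ν := by
  rw [integrable_withDensity_iff_integrable_smul' hr (ae_lt_top hr hfin)] at hF
  rw [integral_withDensity_eq_integral_toReal_smul hr (ae_lt_top hr hfin),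
    integral_prod_symm _ hF, integral_congr_ae (integral_withDensity_section_ae_eq hr hfin)]

end Fubini

/-! ### Transcript densities of interactive protocols -/

noncomputable section

/-- The writing order is the lexicographic order on slots, which makes induction over slots
available. -/
theorem Precedes.toLex_lt {n T : ℕ} {a b : Fin T × Fin n} (h : Precedes a b) :
    toLex a < toLex b :=
  Prod.Lex.toLex_lt_toLex.mpr h

namespace Protocol

variable {𝒳 : Type*} [MeasurableSpace 𝒳] {n T : ℕ} {𝒴 : Fin T × Fin n → Type*}
  [∀ k, MeasurableSpace (𝒴 k)] {ν : ∀ k, Measure (𝒴 k)} (P : Protocol 𝒳 n T 𝒴 ν)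

theorem measurable_dens_comp {γ : Type*} [MeasurableSpace γ] (k : Fin T × Fin n) {g : γ → 𝒳}
    {h : γ → Transcript 𝒴} (hg : Measurable g) (hh : Measurable h) :
    Measurable fun c => P.dens k (g c) (fun a => h c a.1) (h c k) := by
  refine (P.measurable_dens k).comp (hg.prodMk (Measurable.prodMk ?_ ?_))
  · exact measurable_pi_lambda _ fun a => (measurable_pi_apply a.1).comp hh
  · exact (measurable_pi_apply k).comp hh

/-- No density on an empty space has integral `1`, but this contradiction needs some history to
condition on; that history comes from the earlier slots by induction. -/
theorem nonempty_message (P : Protocol 𝒳 n T 𝒴 ν) (x : Fin n → 𝒳) (k : Fin T × Fin n) : Nonempty (𝒴 k) := by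
  induction hk : toLex k using WellFoundedLT.induction generalizing k with
  | ind l ih =>
    subst hk
    have (a : {a : Fin T × Fin n // Precedes a k}) : Nonempty (𝒴 a.1) :=
      ih _ a.2.toLex_lt a.1 rfl
    obtain ⟨h⟩ : Nonempty (History 𝒴 k) := inferInstance
    by_contra hemp
    rw [not_nonempty_iff] at hemp
    have := P.lintegral_dens k (x k.2) h
    simp [Measure.eq_zero_of_isEmpty] at this

variable [∀ k, SigmaFinite (ν k)]

/-- Integrate out the latest slot of `s` first: no other factor sees its message, and its own factor
integrates to `1` for every history. -/
theorem lmarginal_prod_dens (x : Fin n → 𝒳) (s : Finset (Fin T × Fin n)) :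
    lmarginal ν s (fun π => ∏ k ∈ s, P.dens k (x k.2) (fun a => π a.1) (π k)) = 1 := by
  refine Finset.induction_on_max_value (f := toLex) (motive := fun s => lmarginal ν s
    (fun π => ∏ k ∈ s, P.dens k (x k.2) (fun a => π a.1) (π k)) = 1) s ?_ ?_
  · simp; rfl
  · intro m s hm hmax ih
    have hmeas (k) : Measurable fun π : Transcript 𝒴 =>
        P.dens k (x k.2) (fun a => π a.1) (π k) :=
      P.measurable_dens_comp k measurable_const measurable_id
    rw [lmarginal_insert' _ (by fun_prop) hm, ← ih]
    congr 1
    funext π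
    have hne (k) (hk : k ∈ s) (a : Fin T × Fin n) (ha : Precedes a k) : a ≠ m := by
      rintro rfl
      exact absurd ha.toLex_lt (not_lt.mpr (hmax k hk))
    have h1 (z : 𝒴 m) : (fun a : {a : Fin T × Fin n // Precedes a m} =>
        Function.update π m z a.1) = fun a : {a : Fin T × Fin n // Precedes a m} => π a.1 := by
      funext a
      exact Function.update_of_ne (fun h => by simpa [h] using a.2.toLex_lt) _ _
    have h2 (z : 𝒴 m) (k) (hk : k ∈ s) : P.dens k (x k.2)
          (fun a => Function.update π m z a.1) (Function.update π m z k)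
        = P.dens k (x k.2) (fun a => π a.1) (π k) := by
      rw [Function.update_of_ne (ne_of_mem_of_not_mem hk hm)]
      congr 1
      funext a
      exact Function.update_of_ne (hne k hk a.1 a.2) _ _
    simp_rw [Finset.prod_insert hm, Function.update_self, h1]
    rw [lintegral_congr fun z => by rw [Finset.prod_congr rfl (h2 z)],
      lintegral_mul_const, P.lintegral_dens, one_mul]
    exact (P.measurable_dens m).comp (by fun_prop : Measurable fun z =>
      (x m.2, (fun a : {a : Fin T × Fin n // Precedes a m} => π a.1), z))

/-- For fixed data the transition densities multiply up to a probability density. -/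
theorem lintegral_condDensity (x : Fin n → 𝒳) :
    ∫⁻ π, P.condDensity x π ∂(Measure.pi ν) = 1 := by
  have (k : Fin T × Fin n) := P.nonempty_message x k
  obtain ⟨π⟩ : Nonempty (Transcript 𝒴) := inferInstance
  rw [lintegral_eq_lmarginal_univ π]
  exact congrFun (P.lmarginal_prod_dens x Finset.univ) π

omit [∀ k, SigmaFinite (ν k)] in
theorem measurable_condDensity :
    Measurable fun z : (Fin n → 𝒳) × Transcript 𝒴 => P.condDensity z.1 z.2 :=
  Finset.measurable_prod _ fun k _ =>
    P.measurable_dens_comp k ((measurable_pi_apply k.2).comp measurable_fst) measurable_snd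

/-! ### The joint law and its marginals -/

section JointLaw

variable (μ : Measure (Fin n → 𝒳)) [IsProbabilityMeasure μ]

omit [∀ k, SigmaFinite (ν k)] in
theorem measurable_transcriptDensity : Measurable (P.transcriptDensity μ) :=
  (P.measurable_condDensity.comp measurable_swap).lintegral_prod_right'

theorem lintegral_transcriptDensity :
    ∫⁻ π, P.transcriptDensity μ π ∂(Measure.pi ν) = 1 := by
  simp only [transcriptDensity]
  rw [lintegral_lintegral_swap]
  · simp [lintegral_condDensity]
  · exact (P.measurable_condDensity.comp measurable_swap).aemeasurable

/-- The law of the transcript when the data have law `μ`. -/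
def transcriptLaw : Measure (Transcript 𝒴) :=
  (Measure.pi ν).withDensity (P.transcriptDensity μ)

instance : IsProbabilityMeasure (P.transcriptLaw μ) :=
  ⟨by simp [transcriptLaw, lintegral_transcriptDensity]⟩

theorem map_fst_jointLaw : (P.jointLaw μ).map Prod.fst = μ := by
  ext s hs
  rw [Measure.map_apply measurable_fst hs, jointLaw,
    withDensity_apply _ (measurable_fst hs), ← Set.prod_univ, ← Measure.prod_restrict,
    lintegral_prod _ P.measurable_condDensity.aemeasurable]
  simp [lintegral_condDensity]

theorem map_snd_jointLaw : (P.jointLaw μ).map Prod.snd = P.transcriptLaw μ := by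
  ext s hs
  rw [Measure.map_apply measurable_snd hs, jointLaw,
    withDensity_apply _ (measurable_snd hs), ← Set.univ_prod, ← Measure.prod_restrict,
    lintegral_prod_symm _ P.measurable_condDensity.aemeasurable, transcriptLaw,
    withDensity_apply _ hs]
  simp [transcriptDensity]

instance : IsProbabilityMeasure (P.jointLaw μ) where
  measure_univ := by
    rw [← Set.preimage_univ (f := Prod.fst), ← Measure.map_apply measurable_fst .univ,
      map_fst_jointLaw, measure_univ]

theorem ae_transcriptDensity_pos_lt_top : ∀ᵐ π ∂(P.transcriptLaw μ),
    P.transcriptDensity μ π ≠ 0 ∧ P.transcriptDensity μ π ≠ ∞ := by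
  have h := P.measurable_transcriptDensity μ
  refine Filter.Eventually.and ?_ ?_
  · rw [transcriptLaw, ae_withDensity_iff h]
    exact Filter.Eventually.of_forall fun π hπ => hπ
  · refine (withDensity_absolutelyContinuous _ _).ae_le ?_
    exact (ae_lt_top h (by simp [lintegral_transcriptDensity])).mono fun π hπ => hπ.ne

/-- The density of the joint law with respect to the product of its marginals. -/
def informationDensity (z : (Fin n → 𝒳) × Transcript 𝒴) : ℝ≥0∞ :=
  P.condDensity z.1 z.2 / P.transcriptDensity μ z.2

omit [∀ k, SigmaFinite (ν k)] in
theorem measurable_informationDensity : Measurable (P.informationDensity μ) :=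
  P.measurable_condDensity.div ((P.measurable_transcriptDensity μ).comp measurable_snd)

/-- Only transcripts of density `0` or `∞` obstruct cancelling the denominator. The value `∞` is
almost never taken, and where the density is `0` the conditional density vanishes for almost all
data. -/
theorem jointLaw_eq_withDensity :
    P.jointLaw μ = (μ.prod (P.transcriptLaw μ)).withDensity (P.informationDensity μ) := by
  have hp := P.measurable_transcriptDensity μ
  have hr := P.measurable_informationDensity μ
  have hp2 : Measurable fun z : (Fin n → 𝒳) × Transcript 𝒴 => P.transcriptDensity μ z.2 :=
    hp.comp measurable_snd
  rw [transcriptLaw, prod_withDensity_right hp, ← withDensity_mul _ hp2 hr, jointLaw]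
  refine withDensity_congr_ae ?_
  have hm : MeasurableSet {z : (Fin n → 𝒳) × Transcript 𝒴 | P.condDensity z.1 z.2
      = P.transcriptDensity μ z.2 * P.informationDensity μ z} :=
    measurableSet_eq_fun P.measurable_condDensity ((hp.comp measurable_snd).mul hr)
  change ∀ᵐ z ∂_, z ∈ {z : (Fin n → 𝒳) × Transcript 𝒴 | P.condDensity z.1 z.2
      = P.transcriptDensity μ z.2 * P.informationDensity μ z}
  -- The factors are swapped so that the transcript is fixed before the data.
  rw [← Measure.prod_swap, ae_map_iff measurable_swap.aemeasurable (by exact hm),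
    Measure.ae_prod_iff_ae_ae (measurable_swap hm)]
  filter_upwards [ae_lt_top hp (by simp [lintegral_transcriptDensity])] with π hπ
  by_cases h0 : P.transcriptDensity μ π = 0
  · have hs : Measurable fun x => P.condDensity x π :=
      P.measurable_condDensity.comp (measurable_id.prodMk measurable_const)
    filter_upwards [(lintegral_eq_zero_iff hs).mp h0] with x hx
    simpa [h0] using hx
  · exact Filter.Eventually.of_forall fun x => (ENNReal.mul_div_cancel h0 hπ.ne).symm

theorem lintegral_informationDensity :
    ∫⁻ z, P.informationDensity μ z ∂(μ.prod (P.transcriptLaw μ)) = 1 := by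
  rw [← setLIntegral_univ, ← withDensity_apply _ .univ, ← jointLaw_eq_withDensity, measure_univ]

/-- The conditional law of the data given the transcript. -/
def posterior (π : Transcript 𝒴) : Measure (Fin n → 𝒳) :=
  μ.withDensity fun x => P.informationDensity μ (x, π)

end JointLaw

/-! ### Conditional independence given the transcript -/

section Independent

variable (m : Fin n → Measure 𝒳) [∀ i, IsProbabilityMeasure (m i)]

/-- The likelihood of the datum of node `i` given the transcript. -/
def nodeDensity (i : Fin n) (π : Transcript 𝒴) (x : 𝒳) : ℝ≥0∞ :=
  ∏ t : Fin T, P.dens (t, i) x (fun a => π a.1) (π (t, i))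

/-- The conditional law of the datum of node `i` given the transcript. -/
def nodePosterior (i : Fin n) (π : Transcript 𝒴) : Measure 𝒳 :=
  (m i).withDensity fun x => P.nodeDensity i π x / ∫⁻ x, P.nodeDensity i π x ∂(m i)

omit [∀ k, SigmaFinite (ν k)] in
theorem measurable_nodeDensity (i : Fin n) (π : Transcript 𝒴) :
    Measurable (P.nodeDensity i π) :=
  Finset.measurable_prod _ fun t _ => P.measurable_dens_comp (t, i) measurable_id measurable_const

omit [∀ k, SigmaFinite (ν k)] in
-- Group the slots by node: once the transcript is fixed, each channel involves the datum of a
-- single node. All conditional independence rests on this.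
theorem condDensity_eq_prod_nodeDensity (x : Fin n → 𝒳) (π : Transcript 𝒴) :
    P.condDensity x π = ∏ i, P.nodeDensity i π (x i) := by
  simp only [condDensity, nodeDensity]
  rw [Fintype.prod_prod_type_right]

omit [∀ k, SigmaFinite (ν k)] in
theorem transcriptDensity_pi (π : Transcript 𝒴) : P.transcriptDensity (Measure.pi m) π
    = ∏ i, ∫⁻ x, P.nodeDensity i π x ∂(m i) := by
  simp only [transcriptDensity, condDensity_eq_prod_nodeDensity]
  exact lintegral_pi_prod_eval m fun i => P.measurable_nodeDensity i π

omit [∀ k, SigmaFinite (ν k)] in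
-- A nonzero product has only nonzero factors, and then one infinite factor would make it infinite.
theorem lintegral_nodeDensity_ne {π : Transcript 𝒴}
    (h0 : P.transcriptDensity (Measure.pi m) π ≠ 0)
    (h1 : P.transcriptDensity (Measure.pi m) π ≠ ∞) (i : Fin n) :
    ∫⁻ x, P.nodeDensity i π x ∂(m i) ≠ 0 ∧ ∫⁻ x, P.nodeDensity i π x ∂(m i) ≠ ∞ := by
  rw [transcriptDensity_pi] at h0 h1
  have hne := Finset.prod_ne_zero_iff.mp h0
  refine ⟨hne i (Finset.mem_univ i), fun h => h1 ?_⟩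
  rw [← Finset.mul_prod_erase _ _ (Finset.mem_univ i), h, ENNReal.top_mul]
  exact Finset.prod_ne_zero_iff.mpr fun j _ => hne j (Finset.mem_univ j)

omit [∀ k, SigmaFinite (ν k)] in
theorem isProbabilityMeasure_nodePosterior {π : Transcript 𝒴}
    (h0 : P.transcriptDensity (Measure.pi m) π ≠ 0)
    (h1 : P.transcriptDensity (Measure.pi m) π ≠ ∞) (i : Fin n) :
    IsProbabilityMeasure (P.nodePosterior m i π) := by
  obtain ⟨hz, hf⟩ := P.lintegral_nodeDensity_ne m h0 h1 i
  refine ⟨?_⟩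
  rw [nodePosterior, withDensity_apply _ .univ, setLIntegral_univ]
  simp_rw [ENNReal.div_eq_inv_mul]
  rw [lintegral_const_mul _ (P.measurable_nodeDensity i π), ENNReal.inv_mul_cancel hz hf]

omit [∀ k, SigmaFinite (ν k)] in
/-- Independent data stay independent given the transcript. -/
theorem posterior_pi {π : Transcript 𝒴}
    (h0 : P.transcriptDensity (Measure.pi m) π ≠ 0)
    (h1 : P.transcriptDensity (Measure.pi m) π ≠ ∞) :
    P.posterior (Measure.pi m) π = Measure.pi fun i => P.nodePosterior m i π := by
  have hi (i : Fin n) := P.isProbabilityMeasure_nodePosterior m h0 h1 i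
  have hs (i : Fin n) : SigmaFinite ((m i).withDensity fun x =>
      P.nodeDensity i π x / ∫⁻ x, P.nodeDensity i π x ∂(m i)) :=
    inferInstanceAs (SigmaFinite (P.nodePosterior m i π))
  simp only [nodePosterior]
  rw [pi_withDensity m (fun i => (P.measurable_nodeDensity i π).div_const _)]
  simp only [posterior, informationDensity]
  congr 1
  funext x
  rw [condDensity_eq_prod_nodeDensity, transcriptDensity_pi]
  simp_rw [div_eq_mul_inv]
  rw [Finset.prod_mul_distrib]
  congr 1
  refine ENNReal.prod_inv_distrib ?_
  exact fun i _ j _ _ => Or.inl (P.lintegral_nodeDensity_ne m h0 h1 i).1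

end Independent

end Protocol

end

/-! ### Gaussian translations as changes of density -/

noncomputable section

section Shift

theorem gaussianReal_add_eq_withDensity (a b : ℝ) {v : ℝ≥0} (hv : v ≠ 0) :
    gaussianReal (a + b) v = (gaussianReal a v).withDensity
      fun x => ENNReal.ofReal (Real.exp ((x - a) * b / v - b ^ 2 / (2 * v))) := by
  rw [gaussianReal_of_var_ne_zero _ hv, gaussianReal_of_var_ne_zero _ hv,
    ← withDensity_mul _ (measurable_gaussianPDF a v) (by fun_prop)]
  congr 1
  funext x
  simp only [Pi.mul_apply, gaussianPDF, gaussianPDFReal]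
  rw [← ENNReal.ofReal_mul (by positivity), mul_assoc _ (Real.exp _), ← Real.exp_add]
  congr 3
  have : (v : ℝ) ≠ 0 := by exact_mod_cast hv
  field_simp
  ring

theorem map_withDensity_comp {α β : Type*} [MeasurableSpace α] [MeasurableSpace β]
    (μ : Measure α) {g : α → β} (hg : Measurable g) {f : β → ℝ≥0∞} (hf : Measurable f) :
    (μ.withDensity (f ∘ g)).map g = (μ.map g).withDensity f := by
  ext s hs
  rw [Measure.map_apply hg hs, withDensity_apply _ (hg hs), withDensity_apply _ hs,
    setLIntegral_map hs hf hg]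
  rfl

variable {d : ℕ} {σ : ℝ}

/-- Isotropic covariance makes the characteristic function split over coordinates, so the shift
formula reduces to dimension one. -/
theorem multivariateGaussian_smul_one (σ : ℝ) (θ : EuclideanSpace ℝ (Fin d)) :
    multivariateGaussian θ (σ ^ 2 • (1 : Matrix (Fin d) (Fin d) ℝ))
      = (Measure.pi fun j => gaussianReal (θ j) (σ ^ 2).toNNReal).map (WithLp.toLp 2) := by
  have hS : (σ ^ 2 • (1 : Matrix (Fin d) (Fin d) ℝ)).PosSemidef :=
    Matrix.PosSemidef.one.smul (sq_nonneg σ)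
  apply Measure.ext_of_charFun
  ext t
  rw [charFun_multivariateGaussian hS, charFun_pi]
  simp_rw [charFun_gaussianReal, ← Complex.exp_sum]
  congr 1
  simp only [Finset.sum_sub_distrib, ← Finset.sum_mul, Real.coe_toNNReal _ (sq_nonneg σ)]
  congr 1
  · simp [PiLp.inner_apply, mul_comm]
  · simp [Matrix.smul_mulVec, dotProduct, Finset.sum_div, pow_two]
    exact Finset.sum_congr rfl fun i _ => by ring

/-- The logarithm of the density of `N(θ + h, σ² I)` with respect to `N(θ, σ² I)`. -/
def shiftExponent (σ : ℝ) (θ h x : EuclideanSpace ℝ (Fin d)) : ℝ :=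
  inner ℝ (x - θ) h / σ ^ 2 - ‖h‖ ^ 2 / (2 * σ ^ 2)

@[fun_prop]
theorem continuous_shiftExponent (σ : ℝ) (θ h : EuclideanSpace ℝ (Fin d)) :
    Continuous (shiftExponent σ θ h) := by
  unfold shiftExponent
  fun_prop

theorem multivariateGaussian_add_eq_withDensity (hσ : 0 < σ) (θ h : EuclideanSpace ℝ (Fin d)) :
    multivariateGaussian (θ + h) (σ ^ 2 • (1 : Matrix (Fin d) (Fin d) ℝ))
      = (multivariateGaussian θ (σ ^ 2 • (1 : Matrix (Fin d) (Fin d) ℝ))).withDensity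
        fun x => ENNReal.ofReal (Real.exp (shiftExponent σ θ h x)) := by
  have hv : (σ ^ 2).toNNReal ≠ 0 := (Real.toNNReal_pos.mpr (by positivity)).ne'
  have hs (j : Fin d) : SigmaFinite ((gaussianReal (θ j) (σ ^ 2).toNNReal).withDensity
      fun x => ENNReal.ofReal (Real.exp ((x - θ j) * h j / (σ ^ 2).toNNReal
        - h j ^ 2 / (2 * (σ ^ 2).toNNReal)))) := by
    rw [← gaussianReal_add_eq_withDensity _ _ hv]
    infer_instance
  rw [multivariateGaussian_smul_one, multivariateGaussian_smul_one,
    ← map_withDensity_comp _ (by fun_prop) (by fun_prop)]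
  congr 1
  simp only [PiLp.add_apply, gaussianReal_add_eq_withDensity _ _ hv]
  rw [pi_withDensity _ (by fun_prop)]
  congr 1
  funext x
  rw [Function.comp_apply, ← ENNReal.ofReal_prod_of_nonneg (fun _ _ => (Real.exp_pos _).le),
    ← Real.exp_sum]
  congr 2
  simp only [shiftExponent, Finset.sum_sub_distrib, ← Finset.sum_div,
    Real.coe_toNNReal _ (sq_nonneg σ), EuclideanSpace.real_norm_sq_eq, PiLp.inner_apply]
  simp [mul_comm]

theorem lintegral_exp_shiftExponent (hσ : 0 < σ) (θ h : EuclideanSpace ℝ (Fin d)) :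
    ∫⁻ x, ENNReal.ofReal (Real.exp (shiftExponent σ θ h x))
      ∂(multivariateGaussian θ (σ ^ 2 • (1 : Matrix (Fin d) (Fin d) ℝ))) = 1 := by
  rw [← setLIntegral_univ, ← withDensity_apply _ .univ,
    ← multivariateGaussian_add_eq_withDensity hσ, measure_univ]

variable {n : ℕ}

instance (σ : ℝ) (θ : EuclideanSpace ℝ (Fin d)) : IsProbabilityMeasure (gaussianSample d n σ θ) :=
  inferInstanceAs (IsProbabilityMeasure (Measure.pi _))

theorem gaussianSample_add_eq_withDensity (hσ : 0 < σ) (θ h : EuclideanSpace ℝ (Fin d)) :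
    gaussianSample d n σ (θ + h) = (gaussianSample d n σ θ).withDensity
      fun x => ENNReal.ofReal (Real.exp (∑ i, shiftExponent σ θ h (x i))) := by
  have hs : SigmaFinite ((multivariateGaussian θ
      (σ ^ 2 • (1 : Matrix (Fin d) (Fin d) ℝ))).withDensity
        fun x => ENNReal.ofReal (Real.exp (shiftExponent σ θ h x))) := by
    rw [← multivariateGaussian_add_eq_withDensity hσ]
    infer_instance
  simp only [gaussianSample, multivariateGaussian_add_eq_withDensity hσ]
  rw [pi_withDensity _ (by fun_prop)]
  congr 1
  funext x
  rw [← ENNReal.ofReal_prod_of_nonneg (fun _ _ => (Real.exp_pos _).le), ← Real.exp_sum]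

/-- The shift may differ from node to node because it will be a posterior deviation, which does. -/
theorem lintegral_exp_sum_shiftExponent (hσ : 0 < σ) (θ : EuclideanSpace ℝ (Fin d))
    (h : Fin n → EuclideanSpace ℝ (Fin d)) :
    ∫⁻ x, ENNReal.ofReal (Real.exp (∑ i, shiftExponent σ θ (h i) (x i)))
      ∂(gaussianSample d n σ θ) = 1 := by
  simp_rw [Real.exp_sum, ENNReal.ofReal_prod_of_nonneg (fun _ _ => (Real.exp_pos _).le)]
  rw [gaussianSample, lintegral_pi_prod_eval _ (f := fun i x =>
    ENNReal.ofReal (Real.exp (shiftExponent σ θ (h i) x))) (by fun_prop)]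
  simp [lintegral_exp_shiftExponent hσ]

end Shift

/-! ### Exponential moments and differentiation under the integral -/

section Moments

/-- Fernique's theorem gives a square-exponential moment, which dominates every exponential of a
multiple of the norm. -/
theorem integrable_exp_mul_norm_sub {E : Type*} [NormedAddCommGroup E] [NormedSpace ℝ E]
    [MeasurableSpace E] [BorelSpace E] [CompleteSpace E] [SecondCountableTopology E]
    (μ : Measure E) [IsGaussian μ] (c : ℝ) (θ : E) :
    Integrable (fun x => Real.exp (c * ‖x - θ‖)) μ := by
  obtain ⟨C, hC, hint⟩ := IsGaussian.exists_integrable_exp_sq μ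
  refine (hint.const_mul (Real.exp (|c| * ‖θ‖ + c ^ 2 / (4 * C)))).mono' (by fun_prop)
    (Filter.Eventually.of_forall fun x => ?_)
  rw [Real.norm_of_nonneg (Real.exp_pos _).le, ← Real.exp_add]
  refine Real.exp_le_exp.mpr ?_
  have h1 : c * ‖x - θ‖ ≤ |c| * (‖x‖ + ‖θ‖) :=
    (mul_le_mul_of_nonneg_right (le_abs_self c) (norm_nonneg _)).trans
      (mul_le_mul_of_nonneg_left (norm_sub_le _ _) (abs_nonneg c))
  -- Young's inequality, from the square of `|c| - 2C‖x‖`.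
  have h2 : |c| * ‖x‖ ≤ c ^ 2 / (4 * C) + C * ‖x‖ ^ 2 := by
    rw [← sq_abs c, div_add' _ _ _ (by positivity), le_div_iff₀ (by positivity)]
    nlinarith [sq_nonneg (|c| - 2 * C * ‖x‖)]
  linarith

theorem integrable_exp_sum_norm_sub {d n : ℕ} (σ c : ℝ) (θ : EuclideanSpace ℝ (Fin d)) :
    Integrable (fun x => Real.exp (c * ∑ i, ‖x i - θ‖)) (gaussianSample d n σ θ) := by
  simp_rw [Finset.mul_sum, Real.exp_sum]
  exact Integrable.fintype_prod (f := fun _ x => Real.exp (c * ‖x - θ‖))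
    fun i => integrable_exp_mul_norm_sub _ c θ

/-- Half of the exponential rate is spent on absorbing the factor `‖v‖` that differentiation
produces. -/
theorem norm_mul_exp_le {E : Type*} [NormedAddCommGroup E] {c : ℝ} (hc : 0 < c) (v : E) :
    ‖v‖ * Real.exp (c / 2 * ‖v‖) ≤ 2 / c * Real.exp (c * ‖v‖) := by
  have h : c / 2 * ‖v‖ ≤ Real.exp (c / 2 * ‖v‖) :=
    (by linarith : c / 2 * ‖v‖ ≤ c / 2 * ‖v‖ + 1).trans (Real.add_one_le_exp _)
  have h2 : ‖v‖ ≤ 2 / c * Real.exp (c / 2 * ‖v‖) := by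
    rw [div_mul_eq_mul_div, le_div_iff₀ hc]
    linarith
  calc ‖v‖ * Real.exp (c / 2 * ‖v‖)
      ≤ 2 / c * Real.exp (c / 2 * ‖v‖) * Real.exp (c / 2 * ‖v‖) := by gcongr
    _ = 2 / c * Real.exp (c * ‖v‖) := by rw [mul_assoc, ← Real.exp_add]; ring_nf

variable {α E : Type*} [MeasurableSpace α] [NormedAddCommGroup E] [InnerProductSpace ℝ E]
  [CompleteSpace E] {κ : Measure α} {s : α → E} {c : ℝ}

/-- The derivative at the origin of a moment generating function. -/
theorem hasFDerivAt_integral_exp_inner (hs : AEStronglyMeasurable s κ) (hc : 0 < c)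
    (hint : Integrable (fun x => Real.exp (c * ‖s x‖)) κ) :
    HasFDerivAt (fun h => ∫ x, Real.exp (inner ℝ (s x) h) ∂κ) (innerSL ℝ (∫ x, s x ∂κ)) 0 := by
  have hbound : Integrable (fun x => 2 / c * Real.exp (c * ‖s x‖)) κ := hint.const_mul _
  have hs1 : Integrable s κ := by
    refine hbound.mono' hs (Filter.Eventually.of_forall fun x => le_trans ?_ (norm_mul_exp_le hc _))
    exact le_mul_of_one_le_right (norm_nonneg _) (Real.one_le_exp (by positivity))
  have hexp (h : E) : Continuous fun v : E => Real.exp (inner ℝ v h) := by fun_prop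
  have h0 : Integrable (fun x => Real.exp (inner ℝ (s x) 0)) κ := by
    refine hint.mono' ((hexp 0).comp_aestronglyMeasurable hs)
      (Filter.Eventually.of_forall fun x => ?_)
    simp only [inner_zero_right, Real.exp_zero, norm_one]
    exact Real.one_le_exp (by positivity)
  have hSL : Continuous fun v : E => innerSL ℝ v := (innerSL ℝ).continuous
  -- On the ball of radius `c / 2` the derivative is at most `‖s x‖ exp(c/2 ‖s x‖)`, hence uniformly
  -- dominated.
  have key := hasFDerivAt_integral_of_dominated_of_fderiv_le (𝕜 := ℝ) (μ := κ)
    (F := fun h x => Real.exp (inner ℝ (s x) h))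
    (F' := fun h x => Real.exp (inner ℝ (s x) h) • innerSL ℝ (s x)) (x₀ := (0 : E))
    (s := Metric.ball 0 (c / 2)) (bound := fun x => 2 / c * Real.exp (c * ‖s x‖))
    (Metric.ball_mem_nhds _ (half_pos hc))
    (Filter.Eventually.of_forall fun h => (hexp h).comp_aestronglyMeasurable hs) h0
    (((hexp 0).comp_aestronglyMeasurable hs).smul (hSL.comp_aestronglyMeasurable hs))
    (Filter.Eventually.of_forall fun x h hh => ?_) hbound
    (Filter.Eventually.of_forall fun x h _ => ?_)
  · have hi : Integrable (fun x => Real.exp (inner ℝ (s x) (0 : E)) • innerSL ℝ (s x)) κ := by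
      refine hs1.norm.mono' (((hexp 0).comp_aestronglyMeasurable hs).smul
        (hSL.comp_aestronglyMeasurable hs)) (Filter.Eventually.of_forall fun x => ?_)
      simp
    have heq : ∫ x, Real.exp (inner ℝ (s x) (0 : E)) • innerSL ℝ (s x) ∂κ
        = innerSL ℝ (∫ x, s x ∂κ) := ?_
    · exact heq ▸ key
    refine ContinuousLinearMap.ext fun v => ?_
    rw [ContinuousLinearMap.integral_apply hi]
    simp only [inner_zero_right, Real.exp_zero, one_smul, innerSL_apply_apply]
    simp_rw [real_inner_comm v]
    rw [integral_inner hs1]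
  · rw [norm_smul, innerSL_apply_norm, Real.norm_of_nonneg (Real.exp_pos _).le, mul_comm]
    refine le_trans ?_ (norm_mul_exp_le hc _)
    gcongr
    refine (real_inner_le_norm _ _).trans ?_
    rw [mul_comm]
    gcongr
    exact (mem_ball_zero_iff.mp hh).le
  · exact ((innerSL ℝ (s x)).hasFDerivAt).exp

end Moments

end

/-! ### Integration against the posterior -/

noncomputable section

theorem norm_integral_sq_le {α E : Type*} [MeasurableSpace α] [NormedAddCommGroup E]
    [NormedSpace ℝ E] {κ : Measure α} [IsProbabilityMeasure κ] {f : α → E}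
    (hf : Integrable f κ) (hf2 : Integrable (fun x => ‖f x‖ ^ 2) κ) :
    ‖∫ x, f x ∂κ‖ ^ 2 ≤ ∫ x, ‖f x‖ ^ 2 ∂κ := by
  have h := (even_two.convexOn_pow (𝕜 := ℝ)).map_integral_le (continuous_pow 2).continuousOn
    isClosed_univ (Filter.Eventually.of_forall fun x => Set.mem_univ ‖f x‖) hf.norm hf2
  exact (pow_le_pow_left₀ (norm_nonneg _) (norm_integral_le_integral_norm f) 2).trans h

theorem integrable_inner_of_memLp_two {α E : Type*} [MeasurableSpace α] [NormedAddCommGroup E]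
    [InnerProductSpace ℝ E] {κ : Measure α} {f g : α → E} (hf : MemLp f 2 κ) (hg : MemLp g 2 κ) :
    Integrable (fun x => inner ℝ (f x) (g x)) κ :=
  (hf.norm.integrable_mul hg.norm).mono' (hf.aestronglyMeasurable.inner hg.aestronglyMeasurable)
    (Filter.Eventually.of_forall fun _ => norm_inner_le_norm _ _)

namespace Protocol

section Posterior

variable {𝒳 : Type*} [MeasurableSpace 𝒳] {n T : ℕ} {𝒴 : Fin T × Fin n → Type*}
  [∀ k, MeasurableSpace (𝒴 k)] {ν : ∀ k, Measure (𝒴 k)} [∀ k, SigmaFinite (ν k)]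
  (P : Protocol 𝒳 n T 𝒴 ν) (μ : Measure (Fin n → 𝒳)) [IsProbabilityMeasure μ]

theorem lintegral_informationDensity_ne_top :
    ∫⁻ z, P.informationDensity μ z ∂(μ.prod (P.transcriptLaw μ)) ≠ ∞ := by
  simp [lintegral_informationDensity]

variable {V : Type*} [NormedAddCommGroup V] [NormedSpace ℝ V]
  {F : (Fin n → 𝒳) × Transcript 𝒴 → V} {μ}

theorem ae_integrable_posterior (hF : Integrable F (P.jointLaw μ)) :
    ∀ᵐ π ∂(P.transcriptLaw μ), Integrable (fun x => F (x, π)) (P.posterior μ π) := by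
  rw [jointLaw_eq_withDensity] at hF
  exact ae_integrable_withDensity_section (P.measurable_informationDensity μ)
    (P.lintegral_informationDensity_ne_top μ) hF

theorem integrable_integral_posterior (hF : Integrable F (P.jointLaw μ)) :
    Integrable (fun π => ∫ x, F (x, π) ∂(P.posterior μ π)) (P.transcriptLaw μ) := by
  rw [jointLaw_eq_withDensity] at hF
  exact integrable_integral_withDensity_section (P.measurable_informationDensity μ)
    (P.lintegral_informationDensity_ne_top μ) hF

theorem integral_jointLaw (hF : Integrable F (P.jointLaw μ)) :
    ∫ z, F z ∂(P.jointLaw μ)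
      = ∫ π, ∫ x, F (x, π) ∂(P.posterior μ π) ∂(P.transcriptLaw μ) := by
  rw [jointLaw_eq_withDensity] at hF ⊢
  exact integral_prod_withDensity (P.measurable_informationDensity μ)
    (P.lintegral_informationDensity_ne_top μ) hF

theorem measurePreserving_fst_jointLaw : MeasurePreserving Prod.fst (P.jointLaw μ) μ :=
  ⟨measurable_fst, P.map_fst_jointLaw μ⟩

theorem measurePreserving_snd_jointLaw :
    MeasurePreserving Prod.snd (P.jointLaw μ) (P.transcriptLaw μ) :=
  ⟨measurable_snd, P.map_snd_jointLaw μ⟩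

end Posterior

/-! ### Posterior means, the score and the bound in the Gaussian model -/

variable {d n T : ℕ} {𝒴 : Fin T × Fin n → Type*} [∀ k, MeasurableSpace (𝒴 k)]
  {ν : ∀ k, Measure (𝒴 k)} [∀ k, SigmaFinite (ν k)]
  (P : Protocol (EuclideanSpace ℝ (Fin d)) n T 𝒴 ν) (σ : ℝ) (θ : EuclideanSpace ℝ (Fin d))

omit [∀ k, SigmaFinite (ν k)] in
theorem gaussianLaw_eq_transcriptLaw :
    P.gaussianLaw σ θ = P.transcriptLaw (gaussianSample d n σ θ) := rfl

instance : IsProbabilityMeasure (P.gaussianLaw σ θ) :=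
  inferInstanceAs (IsProbabilityMeasure (P.transcriptLaw _))

/-- The conditional expectation of `X i - θ` given the transcript. -/
def posteriorDeviation (i : Fin n) (π : Transcript 𝒴) : EuclideanSpace ℝ (Fin d) :=
  ∫ x, (x i - θ) ∂(P.posterior (gaussianSample d n σ θ) π)

theorem ae_posterior_eq_pi : ∀ᵐ π ∂(P.gaussianLaw σ θ), ∃ τ : Fin n → Measure
    (EuclideanSpace ℝ (Fin d)), (∀ i, IsProbabilityMeasure (τ i)) ∧
      P.posterior (gaussianSample d n σ θ) π = Measure.pi τ := by
  filter_upwards [P.ae_transcriptDensity_pos_lt_top (gaussianSample d n σ θ)] with π hπ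
  exact ⟨_, fun i => P.isProbabilityMeasure_nodePosterior _ hπ.1 hπ.2 i,
    P.posterior_pi _ hπ.1 hπ.2⟩

theorem ae_isProbabilityMeasure_posterior : ∀ᵐ π ∂(P.gaussianLaw σ θ),
    IsProbabilityMeasure (P.posterior (gaussianSample d n σ θ) π) := by
  filter_upwards [P.ae_posterior_eq_pi σ θ] with π ⟨τ, _, hτ⟩
  rw [hτ]
  infer_instance

theorem memLp_sub_gaussianSample (i : Fin n) :
    MemLp (fun x => x i - θ) 2 (gaussianSample d n σ θ) := by
  have h : MemLp (fun x => x - θ) 2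
      (multivariateGaussian θ (σ ^ 2 • (1 : Matrix (Fin d) (Fin d) ℝ))) :=
    IsGaussian.memLp_two_id.sub (memLp_const θ)
  exact h.comp_measurePreserving (measurePreserving_eval (fun _ : Fin n => multivariateGaussian θ
    (σ ^ 2 • (1 : Matrix (Fin d) (Fin d) ℝ))) i)

theorem memLp_sub_jointLaw (i : Fin n) :
    MemLp (fun z => z.1 i - θ) 2 (P.jointLaw (gaussianSample d n σ θ)) :=
  (memLp_sub_gaussianSample σ θ i).comp_measurePreserving P.measurePreserving_fst_jointLaw

theorem integrable_sub_jointLaw (i : Fin n) :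
    Integrable (fun z => z.1 i - θ) (P.jointLaw (gaussianSample d n σ θ)) :=
  (P.memLp_sub_jointLaw σ θ i).integrable one_le_two

theorem memLp_posteriorDeviation (i : Fin n) :
    MemLp (P.posteriorDeviation σ θ i) 2 (P.gaussianLaw σ θ) := by
  have hm : AEStronglyMeasurable (P.posteriorDeviation σ θ i) (P.gaussianLaw σ θ) :=
    (P.integrable_integral_posterior (P.integrable_sub_jointLaw σ θ i)).aestronglyMeasurable
  have h2 : Integrable (fun z => ‖z.1 i - θ‖ ^ 2) (P.jointLaw (gaussianSample d n σ θ)) :=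
    (P.memLp_sub_jointLaw σ θ i).integrable_norm_pow two_ne_zero
  rw [memLp_two_iff_integrable_sq_norm hm]
  refine (P.integrable_integral_posterior h2).mono' (hm.norm.pow 2) ?_
  rw [← gaussianLaw_eq_transcriptLaw]
  filter_upwards [P.ae_isProbabilityMeasure_posterior σ θ, P.ae_integrable_posterior h2,
    P.ae_integrable_posterior (P.integrable_sub_jointLaw σ θ i)] with π hπ hi2 hi
  rw [Real.norm_of_nonneg (by positivity)]
  exact norm_integral_sq_le hi hi2

/-- Posterior independence turns the product of conditional means into the conditional mean of the
product; averaging over transcripts leaves the prior correlation, which is zero. -/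
theorem integral_inner_posteriorDeviation {i j : Fin n} (hij : i ≠ j) :
    ∫ π, inner ℝ (P.posteriorDeviation σ θ i π) (P.posteriorDeviation σ θ j π)
      ∂(P.gaussianLaw σ θ) = 0 := by
  have hint : Integrable (fun x : Fin n → EuclideanSpace ℝ (Fin d) =>
      inner ℝ (x i - θ) (x j - θ)) (gaussianSample d n σ θ) :=
    integrable_inner_of_memLp_two (memLp_sub_gaussianSample σ θ i) (memLp_sub_gaussianSample σ θ j)
  have hint' : Integrable (fun z => inner ℝ (z.1 i - θ) (z.1 j - θ))
      (P.jointLaw (gaussianSample d n σ θ)) :=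
    integrable_inner_of_memLp_two (P.memLp_sub_jointLaw σ θ i) (P.memLp_sub_jointLaw σ θ j)
  have h1 : ∫ π, inner ℝ (P.posteriorDeviation σ θ i π) (P.posteriorDeviation σ θ j π)
      ∂(P.gaussianLaw σ θ) = ∫ z, inner ℝ (z.1 i - θ) (z.1 j - θ)
        ∂(P.jointLaw (gaussianSample d n σ θ)) := by
    rw [P.integral_jointLaw hint', ← gaussianLaw_eq_transcriptLaw]
    have hI := ae_all_iff.mpr fun k =>
      P.ae_integrable_posterior (P.integrable_sub_jointLaw σ θ k)
    refine integral_congr_ae ?_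
    filter_upwards [P.ae_posterior_eq_pi σ θ, hI] with π ⟨τ, hτ, hpi⟩ hI
    simp only [posteriorDeviation]
    rw [hpi] at hI ⊢
    have hτi (k : Fin n) : Integrable (fun x => x - θ) (τ k) :=
      ((measurePreserving_eval τ k).integrable_comp (by fun_prop)).mp (hI k)
    rw [integral_pi_inner τ θ hτi hij]
    have hk (k : Fin n) : ∫ x, (x k - θ) ∂(Measure.pi τ) = ∫ x, (x - θ) ∂(τ k) :=
      integral_comp_eval (μ := τ) (i := k) (f := fun x => x - θ) (by fun_prop)
    rw [hk, hk]
  have h2 : ∫ z, inner ℝ (z.1 i - θ) (z.1 j - θ) ∂(P.jointLaw (gaussianSample d n σ θ))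
      = ∫ x, inner ℝ (x i - θ) (x j - θ) ∂(gaussianSample d n σ θ) := by
    conv_rhs => rw [← P.map_fst_jointLaw (gaussianSample d n σ θ)]
    rw [integral_map measurable_fst.aemeasurable]
    rw [P.map_fst_jointLaw]
    exact hint.aestronglyMeasurable
  have hg : Integrable (fun x => x)
      (multivariateGaussian θ (σ ^ 2 • (1 : Matrix (Fin d) (Fin d) ℝ))) :=
    IsGaussian.integrable_id
  rw [h1, h2, gaussianSample, integral_pi_inner _ θ (fun _ => hg.sub (integrable_const θ)) hij,
    integral_sub hg (integrable_const θ)]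
  simp

theorem integral_norm_sum_posteriorDeviation_sq :
    ∫ π, ‖∑ i, P.posteriorDeviation σ θ i π‖ ^ 2 ∂(P.gaussianLaw σ θ)
      = ∑ i, ∫ π, ‖P.posteriorDeviation σ θ i π‖ ^ 2 ∂(P.gaussianLaw σ θ) := by
  have hint (i j : Fin n) : Integrable (fun π => inner ℝ (P.posteriorDeviation σ θ i π)
      (P.posteriorDeviation σ θ j π)) (P.gaussianLaw σ θ) :=
    integrable_inner_of_memLp_two (P.memLp_posteriorDeviation σ θ i) (P.memLp_posteriorDeviation σ θ j)
  simp_rw [← real_inner_self_eq_norm_sq, sum_inner, inner_sum]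
  rw [integral_finsetSum _ fun i _ => integrable_finsetSum _ fun j _ => hint i j]
  refine Finset.sum_congr rfl fun i _ => ?_
  rw [integral_finsetSum _ fun j _ => hint i j, Finset.sum_eq_single i]
  · exact fun j _ hj => P.integral_inner_posteriorDeviation σ θ hj.symm
  · simp

variable {σ}

/-- The transportation bound, averaged over the transcript. -/
theorem ofReal_sum_integral_posteriorDeviation_le (hσ : 0 < σ) :
    ENNReal.ofReal ((∑ i, ∫ π, ‖P.posteriorDeviation σ θ i π‖ ^ 2 ∂(P.gaussianLaw σ θ))
      / (2 * σ ^ 2)) ≤ P.gaussianInformation σ θ := by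
  set μ := gaussianSample d n σ θ with hμ
  have hL := P.memLp_posteriorDeviation σ θ
  -- Posterior deviations are only known to be almost everywhere measurable; a measurable version
  -- makes the test function below jointly measurable.
  set M : Fin n → Transcript 𝒴 → EuclideanSpace ℝ (Fin d) :=
    fun i => (hL i).aestronglyMeasurable.mk with hM
  have hMm (i : Fin n) : Measurable (M i) :=
    (hL i).aestronglyMeasurable.stronglyMeasurable_mk.measurable
  have hMae (i : Fin n) : P.posteriorDeviation σ θ i =ᵐ[P.gaussianLaw σ θ] M i :=
    (hL i).aestronglyMeasurable.ae_eq_mk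
  have hML (i : Fin n) : MemLp (M i) 2 (P.gaussianLaw σ θ) := (memLp_congr_ae (hMae i)).mp (hL i)
  have hMJ (i : Fin n) : MemLp (fun z => M i z.2) 2 (P.jointLaw μ) :=
    (hML i).comp_measurePreserving P.measurePreserving_snd_jointLaw
  set φ : (Fin n → EuclideanSpace ℝ (Fin d)) × Transcript 𝒴 → ℝ :=
    fun z => ∑ i, shiftExponent σ θ (M i z.2) (z.1 i) with hφ
  have hφm : Measurable φ := by
    simp only [hφ, shiftExponent]
    fun_prop
  have hin (i : Fin n) : Integrable (fun z => inner ℝ (z.1 i - θ) (M i z.2)) (P.jointLaw μ) :=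
    integrable_inner_of_memLp_two (P.memLp_sub_jointLaw σ θ i) (hMJ i)
  have hsq (i : Fin n) : Integrable (fun z => ‖M i z.2‖ ^ 2) (P.jointLaw μ) :=
    (hMJ i).integrable_norm_pow two_ne_zero
  have hφi (i : Fin n) : Integrable (fun z => shiftExponent σ θ (M i z.2) (z.1 i))
      (P.jointLaw μ) := ((hin i).div_const _).sub ((hsq i).div_const _)
  -- Under the product law the data are independent of `π`, so for each `π` this integrates the
  -- density of a shifted Gaussian.
  have hexp : ∫⁻ z, ENNReal.ofReal (Real.exp (φ z)) ∂(μ.prod (P.transcriptLaw μ)) = 1 := by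
    rw [lintegral_prod_symm _ (by fun_prop)]
    simp only [hφ]
    rw [lintegral_congr fun π => lintegral_exp_sum_shiftExponent hσ θ fun i => M i π]
    simp
  have hexpi : Integrable (fun z => Real.exp (φ z)) (μ.prod (P.transcriptLaw μ)) := by
    refine ⟨by fun_prop, ?_⟩
    rw [hasFiniteIntegral_iff_ofReal (Filter.Eventually.of_forall fun z => (Real.exp_pos _).le),
      hexp]
    exact ENNReal.one_lt_top
  have hkl := ofReal_integral_le_klDiv (ρ := P.jointLaw μ) (Q := μ.prod (P.transcriptLaw μ))
    (φ := φ) (integrable_finsetSum _ fun i _ => hφi i) hexpi (by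
      rw [integral_eq_lintegral_of_nonneg_ae
        (Filter.Eventually.of_forall fun z => (Real.exp_pos _).le) (by fun_prop), hexp,
        ENNReal.toReal_one])
  have hval : ∫ z, φ z ∂(P.jointLaw μ)
      = (∑ i, ∫ π, ‖P.posteriorDeviation σ θ i π‖ ^ 2 ∂(P.gaussianLaw σ θ)) / (2 * σ ^ 2) := by
    simp only [hφ]
    rw [integral_finsetSum _ fun i _ => hφi i, Finset.sum_div]
    refine Finset.sum_congr rfl fun i _ => ?_
    -- Conditioning on the transcript replaces `X_i - θ` by its posterior mean, so the linear term
    -- is exactly twice the quadratic one.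
    have e1 : ∫ z, inner ℝ (z.1 i - θ) (M i z.2) ∂(P.jointLaw μ)
        = ∫ π, ‖P.posteriorDeviation σ θ i π‖ ^ 2 ∂(P.gaussianLaw σ θ) := by
      rw [P.integral_jointLaw (hin i), ← gaussianLaw_eq_transcriptLaw]
      refine integral_congr_ae ?_
      filter_upwards [hMae i, P.ae_integrable_posterior (P.integrable_sub_jointLaw σ θ i)]
        with π hπ hI
      simp_rw [real_inner_comm (M i π)]
      rw [integral_inner hI, ← hπ, ← real_inner_self_eq_norm_sq]
      rfl
    have e2 : ∫ z, ‖M i z.2‖ ^ 2 ∂(P.jointLaw μ)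
        = ∫ π, ‖P.posteriorDeviation σ θ i π‖ ^ 2 ∂(P.gaussianLaw σ θ) := by
      have h : ∫ π, ‖P.posteriorDeviation σ θ i π‖ ^ 2 ∂(P.gaussianLaw σ θ)
          = ∫ π, ‖M i π‖ ^ 2 ∂(P.gaussianLaw σ θ) :=
        integral_congr_ae ((hMae i).fun_comp fun v => ‖v‖ ^ 2)
      rw [h, gaussianLaw_eq_transcriptLaw, ← P.map_snd_jointLaw,
        integral_map measurable_snd.aemeasurable (by fun_prop)]
    simp only [shiftExponent]
    rw [integral_sub ((hin i).div_const _) ((hsq i).div_const _), integral_div, integral_div,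
      e1, e2]
    field_simp
    ring
  rw [hval] at hkl
  rwa [gaussianInformation, mutualInformation, map_fst_jointLaw, map_snd_jointLaw]

omit [∀ k, SigmaFinite (ν k)] in
-- Change the data law from `η` to `θ` and apply Bayes' formula. Regularity of the density at `θ`
-- alone expresses it at every `η`.
theorem toReal_gaussianDensity_eq (hσ : 0 < σ) {π : Transcript 𝒴}
    (h0 : P.gaussianDensity σ θ π ≠ 0) (h1 : P.gaussianDensity σ θ π ≠ ∞)
    (η : EuclideanSpace ℝ (Fin d)) :
    (P.gaussianDensity σ η π).toReal = (P.gaussianDensity σ θ π).toReal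
      * ((∫ x, Real.exp (inner ℝ ((σ ^ 2)⁻¹ • ∑ i, (x i - θ)) (η - θ))
          ∂(P.posterior (gaussianSample d n σ θ) π))
        * Real.exp (-(n / (2 * σ ^ 2) * ‖η - θ‖ ^ 2))) := by
  set μ := gaussianSample d n σ θ with hμ
  have hf : Measurable fun x => P.condDensity x π :=
    P.measurable_condDensity.comp (measurable_id.prodMk measurable_const)
  have hr : Measurable fun x => P.informationDensity μ (x, π) :=
    (P.measurable_informationDensity μ).comp (measurable_id.prodMk measurable_const)
  have hD : Measurable fun x : Fin n → EuclideanSpace ℝ (Fin d) =>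
      ENNReal.ofReal (Real.exp (∑ i, shiftExponent σ θ (η - θ) (x i))) := by fun_prop
  have key : P.gaussianDensity σ η π = P.gaussianDensity σ θ π *
      ∫⁻ x, ENNReal.ofReal (Real.exp (∑ i, shiftExponent σ θ (η - θ) (x i)))
        ∂(P.posterior μ π) := by
    have hη : gaussianSample d n σ η = μ.withDensity
        fun x => ENNReal.ofReal (Real.exp (∑ i, shiftExponent σ θ (η - θ) (x i))) := by
      rw [← gaussianSample_add_eq_withDensity hσ, add_sub_cancel]
    rw [gaussianDensity, transcriptDensity, hη, lintegral_withDensity_eq_lintegral_mul _ hD hf,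
      posterior, lintegral_withDensity_eq_lintegral_mul _ hr hD,
      ← lintegral_const_mul _ (hr.mul hD)]
    refine lintegral_congr fun x => ?_
    simp only [Pi.mul_apply, informationDensity]
    rw [← mul_assoc]
    change _ = P.gaussianDensity σ θ π * (P.condDensity x π / P.gaussianDensity σ θ π) * _
    rw [ENNReal.mul_div_cancel h0 h1, mul_comm]
  rw [key, ENNReal.toReal_mul, ← integral_mul_const]
  congr 1
  -- No integrability is needed: if the integral diverges, both conventions give `0`.
  rw [← integral_eq_lintegral_of_nonneg_ae
    (Filter.Eventually.of_forall fun x => (Real.exp_pos _).le)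
    (Measurable.aestronglyMeasurable (by fun_prop))]
  refine integral_congr_ae (Filter.Eventually.of_forall fun x => ?_)
  simp only [← Real.exp_add, shiftExponent]
  congr 1
  rw [Finset.sum_sub_distrib, ← Finset.sum_div, ← sum_inner, real_inner_smul_left]
  simp only [Finset.sum_const, Finset.card_univ, Fintype.card_fin, nsmul_eq_mul]
  ring

/-- Exponential moments of the data pass to almost every posterior, which permits differentiating
its moment generating function. The Gaussian factor is stationary at `η = θ`, so only the posterior
mean survives. -/
theorem ae_hasGradientAt_log_gaussianDensity (hσ : 0 < σ) : ∀ᵐ π ∂(P.gaussianLaw σ θ),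
    HasGradientAt (fun η => Real.log (P.gaussianDensity σ η π).toReal)
      ((σ ^ 2)⁻¹ • ∑ i, P.posteriorDeviation σ θ i π) θ := by
  have hexp : Integrable (fun z => Real.exp ((σ ^ 2)⁻¹ * ∑ i, ‖z.1 i - θ‖))
      (P.jointLaw (gaussianSample d n σ θ)) :=
    P.measurePreserving_fst_jointLaw.integrable_comp_of_integrable
      (integrable_exp_sum_norm_sub σ (σ ^ 2)⁻¹ θ)
  have hI := ae_all_iff.mpr fun k =>
    P.ae_integrable_posterior (P.integrable_sub_jointLaw σ θ k)
  filter_upwards [P.ae_transcriptDensity_pos_lt_top (gaussianSample d n σ θ),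
    P.ae_isProbabilityMeasure_posterior σ θ, P.ae_integrable_posterior hexp, hI]
    with π ⟨h0, h1⟩ hprob hexpπ hI
  set κ := P.posterior (gaussianSample d n σ θ) π with hκ
  set s : (Fin n → EuclideanSpace ℝ (Fin d)) → EuclideanSpace ℝ (Fin d) :=
    fun x => (σ ^ 2)⁻¹ • ∑ i, (x i - θ) with hs
  have hs_int : ∫ x, s x ∂κ = (σ ^ 2)⁻¹ • ∑ i, P.posteriorDeviation σ θ i π := by
    simp only [hs]
    rw [integral_smul, integral_finsetSum _ fun i _ => hI i]
    rfl
  have hsm : AEStronglyMeasurable s κ := by fun_prop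
  have hint : Integrable (fun x => Real.exp (1 * ‖s x‖)) κ := by
    refine hexpπ.mono' (by fun_prop) (Filter.Eventually.of_forall fun x => ?_)
    rw [Real.norm_of_nonneg (Real.exp_pos _).le, one_mul]
    refine Real.exp_le_exp.mpr ?_
    simp only [hs]
    rw [norm_smul, Real.norm_of_nonneg (by positivity)]
    gcongr
    exact norm_sum_le _ _
  have hψ := hasFDerivAt_integral_exp_inner hsm one_pos hint
  have hq : HasFDerivAt (fun h : EuclideanSpace ℝ (Fin d) =>
      Real.exp (-(n / (2 * σ ^ 2) * ‖h‖ ^ 2))) (0 : EuclideanSpace ℝ (Fin d) →L[ℝ] ℝ) 0 := by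
    have h := (((hasStrictFDerivAt_norm_sq (0 : EuclideanSpace ℝ (Fin d))).hasFDerivAt.const_mul
      (n / (2 * σ ^ 2) : ℝ)).neg).exp
    simpa using h
  have hprod := ((hψ.mul hq).const_mul (P.gaussianDensity σ θ π).toReal)
  have hpos : (P.gaussianDensity σ θ π).toReal ≠ 0 := ENNReal.toReal_ne_zero.mpr ⟨h0, h1⟩
  have hlog := hprod.log (by simpa using hpos)
  have hsub : HasFDerivAt (fun η : EuclideanSpace ℝ (Fin d) => η - θ)
      (ContinuousLinearMap.id ℝ (EuclideanSpace ℝ (Fin d))) θ := (hasFDerivAt_id θ).sub_const θ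
  rw [← sub_self θ] at hlog
  have hfin := HasFDerivAt.comp (f := fun η => η - θ) θ hlog hsub
  rw [hasGradientAt_iff_hasFDerivAt]
  refine (hfin.congr_fderiv ?_).congr_of_eventuallyEq ?_
  · refine ContinuousLinearMap.ext fun v => ?_
    rw [← hs_int]
    simp [hpos]
  · refine Filter.Eventually.of_forall fun η => ?_
    simp only [Function.comp_apply]
    rw [P.toReal_gaussianDensity_eq θ hσ h0 h1 η]
    rfl

omit [∀ k, SigmaFinite (ν k)] in
theorem trace_gaussianFisher (h : MemLp (score (P.gaussianDensity σ) θ) 2 (P.gaussianLaw σ θ)) :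
    (P.gaussianFisher σ θ).trace
      = ∫ π, ‖score (P.gaussianDensity σ) θ π‖ ^ 2 ∂(P.gaussianLaw σ θ) := by
  have hj (j : Fin d) : Integrable (fun π => score (P.gaussianDensity σ) θ π j
      * score (P.gaussianDensity σ) θ π j) (P.gaussianLaw σ θ) := by
    have hm := (EuclideanSpace.proj (𝕜 := ℝ) j).comp_memLp' h
    exact hm.integrable_mul hm
  simp only [Matrix.trace, Matrix.diag, gaussianFisher, fisherInformation, Matrix.of_apply]
  change ∑ j, ∫ π, _ ∂(P.gaussianLaw σ θ) = _
  rw [← integral_finsetSum _ fun j _ => hj j]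
  refine integral_congr_ae (Filter.Eventually.of_forall fun π => ?_)
  simp only [EuclideanSpace.real_norm_sq_eq, ← pow_two]

theorem fisherInformation_le_mutualInformation (hσ : 0 < σ) :
    (∀ᵐ π ∂(P.gaussianLaw σ θ),
      DifferentiableAt ℝ (fun η => Real.log (P.gaussianDensity σ η π).toReal) θ) ∧
    MemLp (score (P.gaussianDensity σ) θ) 2 (P.gaussianLaw σ θ) ∧
    ENNReal.ofReal (P.gaussianFisher σ θ).trace
      ≤ ENNReal.ofReal (2 / σ ^ 2) * P.gaussianInformation σ θ := by
  have hgrad := P.ae_hasGradientAt_log_gaussianDensity θ hσ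
  have hscore : score (P.gaussianDensity σ) θ =ᵐ[P.gaussianLaw σ θ]
      fun π => (σ ^ 2)⁻¹ • ∑ i, P.posteriorDeviation σ θ i π :=
    hgrad.mono fun π hπ => hπ.gradient
  have hL : MemLp (score (P.gaussianDensity σ) θ) 2 (P.gaussianLaw σ θ) := by
    have h : MemLp (fun π => ∑ i, P.posteriorDeviation σ θ i π) 2 (P.gaussianLaw σ θ) :=
      memLp_finsetSum _ fun i _ => P.memLp_posteriorDeviation σ θ i
    have h' : MemLp (fun π => (σ ^ 2)⁻¹ • ∑ i, P.posteriorDeviation σ θ i π) 2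
        (P.gaussianLaw σ θ) := h.const_smul (σ ^ 2)⁻¹
    exact h'.ae_eq hscore.symm
  refine ⟨hgrad.mono fun π hπ => hπ.differentiableAt, hL, ?_⟩
  have hnorm : ∫ π, ‖score (P.gaussianDensity σ) θ π‖ ^ 2 ∂(P.gaussianLaw σ θ)
      = ∫ π, ‖(σ ^ 2)⁻¹ • ∑ i, P.posteriorDeviation σ θ i π‖ ^ 2 ∂(P.gaussianLaw σ θ) :=
    integral_congr_ae (hscore.fun_comp fun v => ‖v‖ ^ 2)
  rw [P.trace_gaussianFisher θ hL, hnorm]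
  refine le_trans (le_of_eq ?_)
    (mul_le_mul' le_rfl (P.ofReal_sum_integral_posteriorDeviation_le θ hσ))
  rw [← ENNReal.ofReal_mul (by positivity), ← integral_norm_sum_posteriorDeviation_sq]
  simp_rw [norm_smul, mul_pow]
  rw [integral_const_mul]
  congr 1
  rw [norm_inv, Real.norm_of_nonneg (by positivity)]
  field_simp

end Protocol

end

/-! ### Scalar Gaussian computations -/

noncomputable section

section GaussianReal

/-- Bayes' formula for a Gaussian signal in Gaussian noise: completing the square in `x` separates
the law of the observation from the posterior of the signal. -/
theorem gaussianPDFReal_mul_gaussianPDFReal {s v : ℝ≥0} (hs : s ≠ 0) (hv : v ≠ 0) (a x y : ℝ) :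
    gaussianPDFReal a s x * gaussianPDFReal x v y
      = gaussianPDFReal a (s + v) y
        * gaussianPDFReal ((a * v + y * s) / (s + v)) (s * v / (s + v)) x := by
  have hs' : (0 : ℝ) < s := by exact_mod_cast pos_iff_ne_zero.mpr hs
  have hv' : (0 : ℝ) < v := by exact_mod_cast pos_iff_ne_zero.mpr hv
  simp only [gaussianPDFReal, NNReal.coe_add, NNReal.coe_mul, NNReal.coe_div]
  rw [mul_mul_mul_comm, mul_mul_mul_comm _ (Real.exp _), ← Real.exp_add, ← Real.exp_add,
    ← mul_inv, ← mul_inv, ← Real.sqrt_mul (by positivity), ← Real.sqrt_mul (by positivity)]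
  congr 1
  · congr 2
    field_simp
  · congr 1
    field_simp
    ring

theorem lintegral_gaussianPDF_gaussianReal {s v : ℝ≥0} (hs : s ≠ 0) (hv : v ≠ 0) (a y : ℝ) :
    ∫⁻ x, gaussianPDF x v y ∂(gaussianReal a s) = gaussianPDF a (s + v) y := by
  have hm : Measurable fun x => gaussianPDF x v y :=
    measurable_uncurry_gaussianPDF.comp (by fun_prop : Measurable fun x : ℝ => (x, v, y))
  have hτ : s * v / (s + v) ≠ 0 := by positivity
  rw [gaussianReal_of_var_ne_zero _ hs,
    lintegral_withDensity_eq_lintegral_mul _ (measurable_gaussianPDF a s) hm]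
  have h (x : ℝ) : (gaussianPDF a s * fun x => gaussianPDF x v y) x = gaussianPDF a (s + v) y
      * gaussianPDF ((a * v + y * s) / (s + v)) (s * v / (s + v)) x := by
    simp only [Pi.mul_apply, gaussianPDF]
    rw [← ENNReal.ofReal_mul (gaussianPDFReal_nonneg _ _ _),
      ← ENNReal.ofReal_mul (gaussianPDFReal_nonneg _ _ _), gaussianPDFReal_mul_gaussianPDFReal hs hv]
  rw [lintegral_congr h, lintegral_const_mul _ (measurable_gaussianPDF _ _),
    lintegral_gaussianPDF_eq_one _ hτ, mul_one]

theorem log_gaussianPDFReal {v : ℝ≥0} (hv : v ≠ 0) (a y : ℝ) :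
    Real.log (gaussianPDFReal a v y)
      = -Real.log (2 * Real.pi * v) / 2 - (y - a) ^ 2 / (2 * v) := by
  have hv' : (0 : ℝ) < v := by exact_mod_cast pos_iff_ne_zero.mpr hv
  rw [gaussianPDFReal, Real.log_mul (by positivity) (Real.exp_pos _).ne', Real.log_inv,
    Real.log_sqrt (by positivity), Real.log_exp]
  ring

theorem integral_sub_sq_gaussianReal (a : ℝ) (v : ℝ≥0) :
    ∫ y, (y - a) ^ 2 ∂(gaussianReal a v) = v := by
  rw [← variance_fun_id_gaussianReal (μ := a) (v := v), variance_eq_integral (by fun_prop)]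
  simp

theorem lintegral_sub_sq_gaussianReal (a : ℝ) (v : ℝ≥0) :
    ∫⁻ y, ENNReal.ofReal ((y - a) ^ 2) ∂(gaussianReal a v) = v := by
  have h : MemLp (fun y => y - a) 2 (gaussianReal a v) :=
    (memLp_id_gaussianReal 2).sub (memLp_const a)
  rw [← ofReal_integral_eq_lintegral_ofReal h.integrable_sq
    (Filter.Eventually.of_forall fun y => sq_nonneg _), integral_sub_sq_gaussianReal]
  simp

theorem lintegral_sub_sq_pi_gaussianReal {ι : Type*} [Fintype ι] (a : ι → ℝ) (v : ℝ≥0) (k : ι) :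
    ∫⁻ y, ENNReal.ofReal ((y k - a k) ^ 2) ∂(Measure.pi fun k => gaussianReal (a k) v) = v := by
  rw [← lintegral_sub_sq_gaussianReal (a k) v]
  exact (measurePreserving_eval (fun k => gaussianReal (a k) v) k).lintegral_comp
    (f := fun y => ENNReal.ofReal ((y - a k) ^ 2)) (by fun_prop)

theorem pi_gaussianReal_eq_withDensity {ι : Type*} [Fintype ι] (a : ι → ℝ) {v : ℝ≥0}
    (hv : v ≠ 0) : Measure.pi (fun k => gaussianReal (a k) v)
      = (Measure.pi fun _ => volume).withDensity fun y => ∏ k, gaussianPDF (a k) v (y k) := by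
  have (k : ι) : SigmaFinite (volume.withDensity (gaussianPDF (a k) v)) := by
    rw [← gaussianReal_of_var_ne_zero _ hv]
    infer_instance
  simp only [gaussianReal_of_var_ne_zero _ hv]
  exact pi_withDensity _ fun k => measurable_gaussianPDF _ _

theorem integral_sum_sub_sq_pi_gaussianReal {ι : Type*} [Fintype ι] (a : ℝ) (v : ℝ≥0) :
    ∫ y, (∑ k, (y k - a)) ^ 2 ∂(Measure.pi fun _ : ι => gaussianReal a v)
      = Fintype.card ι * v := by
  have hX (k : ι) : MemLp (fun y => y - a) 2 (gaussianReal a v) :=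
    (memLp_id_gaussianReal 2).sub (memLp_const a)
  have h0 : ∫ y, (y - a) ∂(gaussianReal a v) = 0 := by
    have hid : Integrable (fun y => y) (gaussianReal a v) :=
      (memLp_id_gaussianReal 1).integrable le_rfl
    rw [integral_sub hid (integrable_const a)]
    simp
  have hvar := variance_sum_pi (μ := fun _ : ι => gaussianReal a v)
    (X := fun _ y => y - a) hX
  have hv1 : Var[fun y => y - a; gaussianReal a v] = v := by
    rw [variance_of_integral_eq_zero (by fun_prop) h0]
    exact integral_sub_sq_gaussianReal a v
  rw [hv1] at hvar
  rw [variance_of_integral_eq_zero] at hvar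
  · simpa using hvar
  · fun_prop
  · simp only [Finset.sum_apply]
    rw [integral_finsetSum]
    · refine Finset.sum_eq_zero fun k _ => ?_
      rw [integral_comp_eval (μ := fun _ : ι => gaussianReal a v) (f := fun y => y - a)
        (by fun_prop), h0]
    · exact fun k _ => integrable_comp_eval (μ := fun _ : ι => gaussianReal a v)
        (f := fun y => y - a) ((hX k).integrable one_le_two)

end GaussianReal

/-! ### Optimality through additive Gaussian noise -/

section Awgn

variable {n : ℕ} {v : ℝ≥0} (hv : v ≠ 0) {σ : ℝ} (hσ : 0 < σ)

include hσ in
theorem gaussianDensity_awgnProtocol (η : EuclideanSpace ℝ (Fin 1))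
    (y : Transcript (n := n) (T := 1) fun _ => ℝ) :
    (awgnProtocol n v hv).gaussianDensity σ η y
      = ∏ k, gaussianPDF (η 0) ((σ ^ 2).toNNReal + v) (y k) := by
  have hs : (σ ^ 2).toNNReal ≠ 0 := (Real.toNNReal_pos.mpr (by positivity)).ne'
  have hS : (σ ^ 2 • (1 : Matrix (Fin 1) (Fin 1) ℝ)).PosSemidef :=
    Matrix.PosSemidef.one.smul (sq_nonneg σ)
  rw [Protocol.gaussianDensity, gaussianSample, Protocol.transcriptDensity_pi,
    Fintype.prod_prod_type, Fin.prod_univ_one]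
  refine Finset.prod_congr rfl fun i _ => ?_
  simp only [Protocol.nodeDensity, awgnProtocol, Fin.prod_univ_one]
  have hm : Measurable fun x => gaussianPDF x v (y (0, i)) :=
    measurable_uncurry_gaussianPDF.comp (by fun_prop : Measurable fun x : ℝ => (x, v, y (0, i)))
  have hp := measurePreserving_eval_multivariateGaussian (μ := η) hS (i := 0)
  rw [hp.lintegral_comp hm]
  simpa using lintegral_gaussianPDF_gaussianReal hs hv (η 0) (y (0, i))

include hσ in
theorem gaussianLaw_awgnProtocol (θ : EuclideanSpace ℝ (Fin 1)) :
    (awgnProtocol n v hv).gaussianLaw σ θ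
      = Measure.pi fun _ => gaussianReal (θ 0) ((σ ^ 2).toNNReal + v) := by
  have hw : (σ ^ 2).toNNReal + v ≠ 0 := by positivity
  rw [pi_gaussianReal_eq_withDensity _ hw, Protocol.gaussianLaw]
  congr 1
  funext y
  exact gaussianDensity_awgnProtocol hv hσ θ y

include hσ in
theorem score_awgnProtocol (θ : EuclideanSpace ℝ (Fin 1))
    (y : Transcript (n := n) (T := 1) fun _ => ℝ) :
    score ((awgnProtocol n v hv).gaussianDensity σ) θ y
      = EuclideanSpace.single 0 ((∑ k, (y k - θ 0)) / (σ ^ 2 + v)) := by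
  have hw : (σ ^ 2).toNNReal + v ≠ 0 := by positivity
  have hw' : ((σ ^ 2).toNNReal + v : ℝ≥0) = σ ^ 2 + (v : ℝ) := by
    rw [NNReal.coe_add, Real.coe_toNNReal _ (sq_nonneg σ)]
  have hwpos : (0 : ℝ) < σ ^ 2 + v := by positivity
  refine HasGradientAt.gradient ?_
  have hlog (η : EuclideanSpace ℝ (Fin 1)) :
      Real.log ((awgnProtocol n v hv).gaussianDensity σ η y).toReal
        = ∑ k, (-Real.log (2 * Real.pi * (σ ^ 2 + v)) / 2
          - (y k - η 0) ^ 2 / (2 * (σ ^ 2 + v))) := by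
    rw [gaussianDensity_awgnProtocol hv hσ, ENNReal.toReal_prod, Real.log_prod]
    · refine Finset.sum_congr rfl fun k _ => ?_
      rw [toReal_gaussianPDF, log_gaussianPDFReal hw, hw']
    · exact fun k _ => by
        rw [toReal_gaussianPDF]
        exact (gaussianPDFReal_pos _ _ _ hw).ne'
  simp_rw [hlog]
  rw [hasGradientAt_iff_hasFDerivAt]
  have hproj : HasFDerivAt (fun η : EuclideanSpace ℝ (Fin 1) => η 0)
      (EuclideanSpace.proj (𝕜 := ℝ) (0 : Fin 1)) θ :=
    (EuclideanSpace.proj (𝕜 := ℝ) (0 : Fin 1)).hasFDerivAt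
  have hk (k : Fin 1 × Fin n) := (((hproj.const_sub (y k)).pow 2).mul_const
    (2 * (σ ^ 2 + (v : ℝ)))⁻¹).const_sub (-Real.log (2 * Real.pi * (σ ^ 2 + v)) / 2)
  have hsum := HasFDerivAt.fun_sum (u := Finset.univ) fun k _ => hk k
  simp_rw [← div_eq_mul_inv] at hsum
  refine hsum.congr_fderiv (ContinuousLinearMap.ext fun u => ?_)
  simp only [sum_apply, InnerProductSpace.toDual_apply_apply,
    PiLp.inner_apply, Fin.sum_univ_one]
  rw [Finset.sum_div, PiLp.single_apply, if_pos rfl, RCLike.inner_apply,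
    conj_trivial, Finset.mul_sum]
  refine Finset.sum_congr rfl fun k _ => ?_
  simp
  field_simp

include hσ in
theorem trace_gaussianFisher_awgnProtocol (θ : EuclideanSpace ℝ (Fin 1)) :
    ((awgnProtocol n v hv).gaussianFisher σ θ).trace = n / (σ ^ 2 + v) := by
  have hwpos : (0 : ℝ) < σ ^ 2 + v := by positivity
  rw [Protocol.trace_gaussianFisher _ _
    -- The general bound is used here only for the square integrability of the score.
    ((awgnProtocol n v hv).fisherInformation_le_mutualInformation θ hσ).2.1,
    gaussianLaw_awgnProtocol hv hσ]
  simp_rw [score_awgnProtocol hv hσ, PiLp.norm_single, Real.norm_eq_abs, sq_abs, div_pow]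
  rw [integral_div, integral_sum_sub_sq_pi_gaussianReal]
  simp [Real.coe_toNNReal _ (sq_nonneg σ)]
  field_simp

/-- Given the data, `y_k - x_k` is the noise, whose second moment does not depend on the data. -/
theorem lintegral_sub_sq_jointLaw_awgnProtocol (θ : EuclideanSpace ℝ (Fin 1))
    (k : Fin 1 × Fin n) :
    ∫⁻ z, ENNReal.ofReal ((z.2 k - z.1 k.2 0) ^ 2)
      ∂((awgnProtocol n v hv).jointLaw (gaussianSample 1 n σ θ)) = v := by
  have hF : Measurable fun z : (Fin n → EuclideanSpace ℝ (Fin 1)) ×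
      Transcript (n := n) (T := 1) (fun _ => ℝ) =>
      ENNReal.ofReal ((z.2 k - z.1 k.2 0) ^ 2) := by fun_prop
  have hf := (awgnProtocol n v hv).measurable_condDensity
  rw [Protocol.jointLaw, lintegral_withDensity_eq_lintegral_mul _ hf hF,
    lintegral_prod _ (hf.mul hF).aemeasurable]
  have h (x : Fin n → EuclideanSpace ℝ (Fin 1)) :
      ∫⁻ y, (awgnProtocol n v hv).condDensity x y * ENNReal.ofReal ((y k - x k.2 0) ^ 2)
        ∂(Measure.pi fun _ => volume) = v := by
    rw [← lintegral_sub_sq_pi_gaussianReal (fun k : Fin 1 × Fin n => x k.2 0) v k,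
      pi_gaussianReal_eq_withDensity _ hv, lintegral_withDensity_eq_lintegral_mul]
    · rfl
    · exact Finset.measurable_prod _ fun k _ =>
        (measurable_gaussianPDF _ _).comp (measurable_pi_apply k)
    · fun_prop
  exact (lintegral_congr h).trans (by simp)

include hσ in
-- The two quadratic terms of the log-likelihood ratio both have mean `1/2` and cancel, leaving
-- `log(w/v) / 2` per node; then `log t ≤ t - 1` suffices.
theorem gaussianInformation_awgnProtocol_le (θ : EuclideanSpace ℝ (Fin 1)) :
    (awgnProtocol n v hv).gaussianInformation σ θ
      ≤ ENNReal.ofReal (n * (σ ^ 2 / (2 * v))) := by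
  set P := awgnProtocol n v hv with hP
  set μ := gaussianSample 1 n σ θ with hμ
  have hw : (σ ^ 2).toNNReal + v ≠ 0 := by positivity
  have hw' : ((σ ^ 2).toNNReal + v : ℝ≥0) = σ ^ 2 + (v : ℝ) := by
    rw [NNReal.coe_add, Real.coe_toNNReal _ (sq_nonneg σ)]
  have hv' : (0 : ℝ) < v := by exact_mod_cast pos_iff_ne_zero.mpr hv
  set w : ℝ := σ ^ 2 + v with hwdef
  have hwpos : 0 < w := by positivity
  have hx (k : Fin 1 × Fin n) : Integrable (fun z => (z.2 k - z.1 k.2 0) ^ 2) (P.jointLaw μ)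
      ∧ ∫ z, (z.2 k - z.1 k.2 0) ^ 2 ∂(P.jointLaw μ) = v := by
    have h := lintegral_sub_sq_jointLaw_awgnProtocol hv (σ := σ) θ k
    constructor
    · refine ⟨Measurable.aestronglyMeasurable (by fun_prop), ?_⟩
      rw [hasFiniteIntegral_iff_ofReal (Filter.Eventually.of_forall fun z => sq_nonneg _), h]
      exact ENNReal.coe_lt_top
    · rw [integral_eq_lintegral_of_nonneg_ae (Filter.Eventually.of_forall fun z => sq_nonneg _)
        (Measurable.aestronglyMeasurable (by fun_prop)), h, ENNReal.coe_toReal]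
  have hy (k : Fin 1 × Fin n) : Integrable (fun z => (z.2 k - θ 0) ^ 2) (P.jointLaw μ)
      ∧ ∫ z, (z.2 k - θ 0) ^ 2 ∂(P.jointLaw μ) = w := by
    have h : ∫⁻ z, ENNReal.ofReal ((z.2 k - θ 0) ^ 2) ∂(P.jointLaw μ)
        = ((σ ^ 2).toNNReal + v : ℝ≥0) := by
      rw [← lintegral_sub_sq_pi_gaussianReal (fun _ : Fin 1 × Fin n => θ 0) _ k,
        ← gaussianLaw_awgnProtocol hv hσ, Protocol.gaussianLaw_eq_transcriptLaw]
      exact P.measurePreserving_snd_jointLaw.lintegral_comp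
        (f := fun y => ENNReal.ofReal ((y k - θ 0) ^ 2)) (by fun_prop)
    constructor
    · refine ⟨Measurable.aestronglyMeasurable (by fun_prop), ?_⟩
      rw [hasFiniteIntegral_iff_ofReal (Filter.Eventually.of_forall fun z => sq_nonneg _), h]
      exact ENNReal.coe_lt_top
    · rw [integral_eq_lintegral_of_nonneg_ae (Filter.Eventually.of_forall fun z => sq_nonneg _)
        (Measurable.aestronglyMeasurable (by fun_prop)), h, ENNReal.coe_toReal, hw']
  have hac : P.jointLaw μ ≪ μ.prod (P.transcriptLaw μ) := by
    rw [Protocol.jointLaw_eq_withDensity]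
    exact withDensity_absolutelyContinuous _ _
  have hllr : llr (P.jointLaw μ) (μ.prod (P.transcriptLaw μ)) =ᵐ[P.jointLaw μ] fun z =>
      ∑ k, (Real.log (w / v) / 2 - (z.2 k - z.1 k.2 0) ^ 2 / (2 * v)
        + (z.2 k - θ 0) ^ 2 / (2 * w)) := by
    have hrn : (P.jointLaw μ).rnDeriv (μ.prod (P.transcriptLaw μ))
        =ᵐ[μ.prod (P.transcriptLaw μ)] P.informationDensity μ := by
      rw [Protocol.jointLaw_eq_withDensity]
      exact Measure.rnDeriv_withDensity _ (P.measurable_informationDensity μ)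
    filter_upwards [hac.ae_le hrn] with z hz
    have hden : P.transcriptDensity μ z.2
        = ∏ k, gaussianPDF (θ 0) ((σ ^ 2).toNNReal + v) (z.2 k) :=
      gaussianDensity_awgnProtocol hv hσ θ z.2
    have hcond : P.condDensity z.1 z.2 = ∏ k, gaussianPDF (z.1 k.2 0) v (z.2 k) := rfl
    have hne (b : ℝ) (u : ℝ≥0) (hu : u ≠ 0) (y : ℝ) : (gaussianPDF b u y).toReal ≠ 0 := by
      rw [toReal_gaussianPDF]
      exact (gaussianPDFReal_pos _ _ _ hu).ne'
    rw [llr, hz, Protocol.informationDensity, hden, hcond, ENNReal.toReal_div,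
      ENNReal.toReal_prod, ENNReal.toReal_prod, Real.log_div
        (Finset.prod_ne_zero_iff.mpr fun k _ => hne _ _ hv _)
        (Finset.prod_ne_zero_iff.mpr fun k _ => hne _ _ hw _),
      Real.log_prod fun k _ => hne _ _ hv _, Real.log_prod fun k _ => hne _ _ hw _,
      ← Finset.sum_sub_distrib]
    refine Finset.sum_congr rfl fun k _ => ?_
    rw [toReal_gaussianPDF, toReal_gaussianPDF, log_gaussianPDFReal hv, log_gaussianPDFReal hw,
      hw', Real.log_div hwpos.ne' hv'.ne', Real.log_mul (by positivity) hv'.ne',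
      Real.log_mul (by positivity) hwpos.ne']
    ring
  have hterm (k : Fin 1 × Fin n) : Integrable (fun z => Real.log (w / v) / 2
      - (z.2 k - z.1 k.2 0) ^ 2 / (2 * v) + (z.2 k - θ 0) ^ 2 / (2 * w)) (P.jointLaw μ) :=
    ((integrable_const _).sub ((hx k).1.div_const _)).add ((hy k).1.div_const _)
  have hint : Integrable (llr (P.jointLaw μ) (μ.prod (P.transcriptLaw μ))) (P.jointLaw μ) :=
    (integrable_congr hllr).mpr (integrable_finsetSum _ fun k _ => hterm k)
  have hval : ∫ z, llr (P.jointLaw μ) (μ.prod (P.transcriptLaw μ)) z ∂(P.jointLaw μ)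
      = n * (Real.log (w / v) / 2) := by
    rw [integral_congr_ae hllr, integral_finsetSum _ fun k _ => hterm k]
    have hk (k : Fin 1 × Fin n) : ∫ z, (Real.log (w / v) / 2
        - (z.2 k - z.1 k.2 0) ^ 2 / (2 * v) + (z.2 k - θ 0) ^ 2 / (2 * w)) ∂(P.jointLaw μ)
        = Real.log (w / v) / 2 := by
      have hi : Integrable (fun z => Real.log (w / v) / 2 - (z.2 k - z.1 k.2 0) ^ 2 / (2 * v))
          (P.jointLaw μ) := (integrable_const _).sub ((hx k).1.div_const _)
      rw [integral_add hi ((hy k).1.div_const _),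
        integral_sub (integrable_const _) ((hx k).1.div_const _), integral_div (2 * (v : ℝ)),
        integral_div (2 * w), (hx k).2, (hy k).2]
      simp only [integral_const, probReal_univ, one_smul]
      field_simp
      ring
    rw [Finset.sum_congr rfl fun k _ => hk k]
    simp
  rw [Protocol.gaussianInformation, mutualInformation, Protocol.map_fst_jointLaw,
    Protocol.map_snd_jointLaw, klDiv_of_ac_of_integrable hac hint, hval]
  refine ENNReal.ofReal_le_ofReal ?_
  simp only [probReal_univ, add_sub_cancel_right]
  refine mul_le_mul_of_nonneg_left ?_ (Nat.cast_nonneg n)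
  have := Real.log_le_sub_one_of_pos (div_pos hwpos hv')
  have h2 : w / v - 1 = σ ^ 2 / v := by
    rw [hwdef]
    field_simp
    ring
  rw [h2] at this
  calc Real.log (w / v) / 2 ≤ σ ^ 2 / v / 2 := by gcongr
    _ = σ ^ 2 / (2 * v) := by rw [div_div, mul_comm]

include hσ in
theorem mul_gaussianInformation_awgnProtocol_lt (hn : 1 ≤ n) (θ : EuclideanSpace ℝ (Fin 1))
    {c : ℝ} (hcv : c * (σ ^ 2 + v) < 2 * v) :
    ENNReal.ofReal (c / σ ^ 2) * (awgnProtocol n v hv).gaussianInformation σ θ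
      < ENNReal.ofReal ((awgnProtocol n v hv).gaussianFisher σ θ).trace := by
  have hv' : (0 : ℝ) < v := by exact_mod_cast pos_iff_ne_zero.mpr hv
  have hn' : (0 : ℝ) < n := by exact_mod_cast hn
  refine (mul_le_mul' le_rfl (gaussianInformation_awgnProtocol_le hv hσ θ)).trans_lt ?_
  -- Only the second factor is known to be nonnegative, since `c` may be negative.
  rw [← ENNReal.ofReal_mul' (by positivity), trace_gaussianFisher_awgnProtocol hv hσ,
    ENNReal.ofReal_lt_ofReal_iff (by positivity), lt_div_iff₀ (by positivity)]
  have h : c / σ ^ 2 * (n * (σ ^ 2 / (2 * v))) * (σ ^ 2 + v)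
      = n * (c * (σ ^ 2 + v) / (2 * v)) := by
    field_simp
  rw [h]
  have : c * (σ ^ 2 + v) / (2 * v) < 1 := by
    rwa [div_lt_one (by positivity)]
  nlinarith

end Awgn

end
theorem corollary2 :
    -- the bound, for every interactive protocol
    (∀ (d n T : ℕ) (σ : ℝ), 0 < σ →
      ∀ (𝒴 : Fin T × Fin n → Type*) [∀ k, MeasurableSpace (𝒴 k)]
        (ν : ∀ k, Measure (𝒴 k)) [∀ k, SigmaFinite (ν k)]
        (P : Protocol (EuclideanSpace ℝ (Fin d)) n T 𝒴 ν) (θ : EuclideanSpace ℝ (Fin d)),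
        (∀ᵐ π ∂(P.gaussianLaw σ θ),
          DifferentiableAt ℝ (fun η => Real.log (P.gaussianDensity σ η π).toReal) θ) ∧
        MemLp (score (P.gaussianDensity σ) θ) 2 (P.gaussianLaw σ θ) ∧
        ENNReal.ofReal (P.gaussianFisher σ θ).trace
          ≤ ENNReal.ofReal (2 / σ ^ 2) * P.gaussianInformation σ θ) ∧
    -- the constant 2 is optimal, already for one round of independent Gaussian channels
    (∀ (n : ℕ) (σ : ℝ) (θ : EuclideanSpace ℝ (Fin 1)) (c : ℝ), 1 ≤ n → 0 < σ → c < 2 →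
      ∃ v₀ : ℝ≥0, ∀ (v : ℝ≥0) (hv : v ≠ 0), v₀ ≤ v →
        ENNReal.ofReal (c / σ ^ 2) * (awgnProtocol n v hv).gaussianInformation σ θ
          < ENNReal.ofReal ((awgnProtocol n v hv).gaussianFisher σ θ).trace) := by
  refine ⟨fun d n T σ hσ 𝒴 _ ν _ P θ => P.fisherInformation_le_mutualInformation θ hσ,
    -- The threshold solves `c(σ² + v) < 2v` for `v`; the `+ 1` makes the inequality strict.
    fun n σ θ c hn hσ hc => ⟨(c * σ ^ 2 / (2 - c) + 1).toNNReal, fun v hv hle => ?_⟩⟩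
  refine mul_gaussianInformation_awgnProtocol_lt hv hσ hn θ ?_
  have h : c * σ ^ 2 / (2 - c) < v :=
    (lt_add_one _).trans_le (Real.toNNReal_le_iff_le_coe.mp hle)
  rw [div_lt_iff₀ (by linarith)] at h
  linarith
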